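/- Manifolds and Lie groups are finite-dimensional, smooth, Hausdorff and second countable, and a pseudo-Riemannian metric is a smooth field of non-degenerate symmetric bilinear forms on the tangent spaces. Let $M$ be a connected manifold with base point $P_0$, let $\mathcal H$ be a connected Lie group that acts on $M$, with isotropy group $\mathcal H_0=\{\Phi\in\mathcal H:\Phi P_0=P_0\}$, and let $\lambda:\mathcal H\to\mathbb R$ be a function. For a pseudo-Riemannian metric $g_0$ on $M$, the quadruple $(M,g_0,\mathcal H,\lambda)$ is called a $\mathfrak P$-structure if $\mathcal H$ acts smoothly, transitively and effectively by isometries on $(M,g_0)$, if $\lambda$ is a non-trivial smooth homomorphism from $\mathcal H$ to the multiplicative group $\mathbb R^+$, and if $\mathcal H_0\subset\ker\lambda$. In that case let $M_t:=\lambda^{-1}\{t\}/\mathcal H_0=\{\Phi P_0:\Phi\in\mathcal H,\ \lambda(\Phi)=t\}$ for $t>0$; the metric $g_\lambda$ on $M$ is defined by $g_\lambda(P)=t^2g_0(P)$ for $P\in M_t$. For a pseudo-Riemannian metric $g$ on $M$, we say that $(M,g)$ is homothety homogeneous with homothety character $\lambda$ (with respect to $\mathcal H$) if $\mathcal H$ acts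 smoothly, transitively and effectively on $M$ and if $\lambda(\Phi)>0$ and $\Phi^*g=\lambda(\Phi)^2g$ for all $\Phi\in\mathcal H$. In particular, the group of all homotheties of $(M,g)$ (diffeomorphisms $T$ of $M$ with $T^*g=c^2g$ for some constant $c>0$) then acts transitively on $M$. The manifold $(M,g)$ is called VSI if all its Weyl scalar invariants vanish identically, that is, if every complete contraction (by means of the metric, indices being contracted in pairs) of a tensor product of one or more of the covariant derivatives $\nabla^kR$, $k\ge0$, of the curvature tensor of $g$ is zero on $M$. (1) If $(M,g_0,\mathcal H,\lambda)$ is a $\mathfrak P$-structure, then $g_\lambda$ is a well-defined (smooth) pseudo-Riemannian metric on $M$, and $(M,g_\lambda)$ is homothety homogeneous with homothety character $\lambda$. (2) Conversely, if $(M,g)$ is homothety homogeneous with homothety character $\lambda$, if $\lambda$ is non-trivial (that is, $\lambda\not\equiv1$), and if $(M,g)$ is not VSI, then there is a pseudo-Riemannian metric $g_0$ on $M$ such that $(M,g_0,\mathcal H,\lambda)$ is a $\mathfrak P$-structure and $g=g_\lambda$. -/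

import Mathlib

open scoped Manifold ContDiff Bundle

noncomputable section

/-- A smooth pseudo-Riemannian metric on a manifold `M` modelled on `E`: a smooth field of
symmetric non-degenerate bilinear forms on the tangent spaces. -/
structure PseudoRiemannianMetric (E : Type*) [NormedAddCommGroup E] [NormedSpace ℝ E]
    (M : Type*) [TopologicalSpace M] [ChartedSpace E M] [IsManifold 𝓘(ℝ, E) ∞ M] where
  inner : ∀ p : M, TangentSpace 𝓘(ℝ, E) p →L[ℝ] TangentSpace 𝓘(ℝ, E) p →L[ℝ] ℝ
  symm : ∀ (p : M) (v w : TangentSpace 𝓘(ℝ, E) p), inner p v w = inner p w v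
  nondegenerate : ∀ (p : M) (v : TangentSpace 𝓘(ℝ, E) p), (∀ w, inner p v w = 0) → v = 0
  contMDiff : ContMDiff 𝓘(ℝ, E) (𝓘(ℝ, E).prod 𝓘(ℝ, E →L[ℝ] E →L[ℝ] ℝ)) ∞
    (fun p : M ↦ Bundle.TotalSpace.mk' (E →L[ℝ] E →L[ℝ] ℝ)
      (E := fun p : M ↦ TangentSpace 𝓘(ℝ, E) p →L[ℝ] TangentSpace 𝓘(ℝ, E) p →L[ℝ] ℝ)
      p (inner p))

/-! ### Curvature of a metric in coordinates

`G : E → E →L[ℝ] E →L[ℝ] ℝ` is a field of bilinear forms on (an open subset of) the vector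
space `E`; vectors of `E` are regarded as constant (coordinate) vector fields. -/

section Coordinates

variable {E : Type*} [NormedAddCommGroup E] [NormedSpace ℝ E]

/-- Christoffel symbols of the first kind, as the covector
`w ↦ (1/2) (D_u G (v, w) + D_v G (u, w) - D_w G (u, v))`. -/
def christoffelLower (G : E → E →L[ℝ] E →L[ℝ] ℝ) (x u v : E) : E →L[ℝ] ℝ :=
  (1 / 2 : ℝ) • (fderiv ℝ G x u v + fderiv ℝ G x v u - ((fderiv ℝ G x).flip u).flip v)

/-- Christoffel symbols of the second kind: the vector `∇_u v` at `x`, for the constant vector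
fields `u` and `v` and the Levi-Civita connection `∇` of `G`. -/
def christoffel (G : E → E →L[ℝ] E →L[ℝ] ℝ) (x u v : E) : E :=
  (G x).inverse (christoffelLower G x u v)

/-- The curvature operator `R(u, v) z = ∇_u ∇_v z - ∇_v ∇_u z` at `x`, for constant vector
fields `u, v, z`. -/
def curvatureOperator (G : E → E →L[ℝ] E →L[ℝ] ℝ) (x u v z : E) : E :=
  fderiv ℝ (fun y ↦ christoffel G y v z) x u - fderiv ℝ (fun y ↦ christoffel G y u z) x v
    + christoffel G x u (christoffel G x v z) - christoffel G x v (christoffel G x u z)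

/-- The covariant derivative of a covariant tensor field `T` of rank `k`. The direction of
differentiation is the first argument of the result. -/
def covariantDerivative (G : E → E →L[ℝ] E →L[ℝ] ℝ) {k : ℕ} (T : E → (Fin k → E) → ℝ) :
    E → (Fin (k + 1) → E) → ℝ :=
  fun x v ↦ fderiv ℝ (fun y ↦ T y (Fin.tail v)) x (v 0)
    - ∑ s : Fin k, T x (Function.update (Fin.tail v) s (christoffel G x (v 0) (v s.succ)))

/-- The `k`-th covariant derivative `∇^k R` of the curvature tensor
`R(u, v, z, w) = G(R(u, v) z, w)`. -/
def nablaCurvature (G : E → E →L[ℝ] E →L[ℝ] ℝ) : (k : ℕ) → E → (Fin (4 + k) → E) → ℝ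
  | 0 => fun x v ↦ G x (curvatureOperator G x (v 0) (v 1) (v 2)) (v 3)
  | k + 1 => covariantDerivative G (nablaCurvature G k)

end Coordinates

/-- The combinatorial data of a complete contraction of a product
`∇^{k₁} R ⊗ ⋯ ⊗ ∇^{kₙ} R` with `n ≥ 1`: the `n` orders of differentiation and a decomposition of
the set of all tensor slots (slot `s` of factor `i` being the pair `⟨i, s⟩`) into pairs. The two
slots of pair number `j` are those that correspond to `Sum.inl j` and `Sum.inr j`. -/
structure WeylContraction where
  factors : ℕ
  factors_pos : 0 < factors
  order : Fin factors → ℕ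
  pairs : ℕ
  pairing : (Σ i : Fin factors, Fin (4 + order i)) ≃ Fin pairs ⊕ Fin pairs

/-- The complete contraction described by `c`, at the point `x`, for the metric `G`:
`∑ G^{a₁ b₁} ⋯ G^{a_r b_r} (∇^{k₁} R ⊗ ⋯ ⊗ ∇^{kₙ} R)_{…}`, where the sum is over all the
indices and `G^{ab}` are the entries of the inverse matrix of `(G(e_a, e_b))`, for a basis `e`
of `E`. -/
def WeylContraction.coordValue {E : Type*} [NormedAddCommGroup E] [NormedSpace ℝ E]
    [FiniteDimensional ℝ E] (c : WeylContraction) (G : E → E →L[ℝ] E →L[ℝ] ℝ) (x : E) : ℝ :=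
  let e := Module.finBasis ℝ E
  let Ginv : Matrix _ _ ℝ := (Matrix.of fun a b ↦ G x (e a) (e b))⁻¹
  ∑ a : Fin c.pairs → Fin (Module.finrank ℝ E), ∑ b : Fin c.pairs → Fin (Module.finrank ℝ E),
    (∏ j, Ginv (a j) (b j)) *
      ∏ i, nablaCurvature G (c.order i) x (fun s ↦ e (Sum.elim a b (c.pairing ⟨i, s⟩)))

namespace PseudoRiemannianMetric

variable {E : Type*} [NormedAddCommGroup E] [NormedSpace ℝ E]
  {M : Type*} [TopologicalSpace M] [ChartedSpace E M] [IsManifold 𝓘(ℝ, E) ∞ M]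

/-- The coordinate expression of `g` in the preferred chart at `p`: the pull-back of `g` by the
inverse of that chart. -/
def inChart (g : PseudoRiemannianMetric E M) (p : M) (x : E) : E →L[ℝ] E →L[ℝ] ℝ :=
  ContinuousLinearMap.bilinearComp (E := E) (F := E)
    (g.inner ((extChartAt 𝓘(ℝ, E) p).symm x))
    (mfderiv 𝓘(ℝ, E) 𝓘(ℝ, E) (extChartAt 𝓘(ℝ, E) p).symm x)
    (mfderiv 𝓘(ℝ, E) 𝓘(ℝ, E) (extChartAt 𝓘(ℝ, E) p).symm x)

/-- The Weyl scalar invariant of `g` given by the complete contraction `c`, as a function on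
`M`. -/
def weylScalar [FiniteDimensional ℝ E] (g : PseudoRiemannianMetric E M) (c : WeylContraction)
    (p : M) : ℝ :=
  c.coordValue (g.inChart p) (extChartAt 𝓘(ℝ, E) p p)

/-- Vanishing scalar invariants: all Weyl scalar invariants vanish identically. (These are the
linear combinations of complete contractions, so it suffices to look at the latter.) -/
def IsVSI [FiniteDimensional ℝ E] (g : PseudoRiemannianMetric E M) : Prop :=
  ∀ (c : WeylContraction) (p : M), g.weylScalar c p = 0

/-- `T^* g = c² g`. -/
def PullbackEqSq (g : PseudoRiemannianMetric E M) (T : M → M) (c : ℝ) : Prop :=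
  ∀ (p : M) (v w : TangentSpace 𝓘(ℝ, E) p),
    g.inner (T p) (mfderiv 𝓘(ℝ, E) 𝓘(ℝ, E) T p v) (mfderiv 𝓘(ℝ, E) 𝓘(ℝ, E) T p w)
      = c ^ 2 * g.inner p v w

/-- The group of all homotheties of `(M, g)` acts transitively on `M`. -/
def IsHomothetyHomogeneous (g : PseudoRiemannianMetric E M) : Prop :=
  ∀ p q : M, ∃ T : Diffeomorph 𝓘(ℝ, E) 𝓘(ℝ, E) M M ∞,
    (∃ c : ℝ, 0 < c ∧ g.PullbackEqSq T c) ∧ T p = q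

end PseudoRiemannianMetric

section Action

variable {E : Type*} [NormedAddCommGroup E] [NormedSpace ℝ E]
  {M : Type*} [TopologicalSpace M] [ChartedSpace E M] [IsManifold 𝓘(ℝ, E) ∞ M]
  (F : Type*) [NormedAddCommGroup F] [NormedSpace ℝ F]
  {H : Type*} [TopologicalSpace H] [ChartedSpace F H] [Group H] [MulAction H M]

/-- The Lie group `H` (modelled on `F`) acts smoothly, transitively and effectively on `(M, g)`
by homotheties, and `lam h > 0` is the homothety constant of `h`. -/
structure HasHomothetyCharacter (g : PseudoRiemannianMetric E M) (lam : H → ℝ) : Prop where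
  smooth_action : ContMDiffSMul 𝓘(ℝ, F) 𝓘(ℝ, E) ∞ H M
  transitive : MulAction.IsPretransitive H M
  effective : FaithfulSMul H M
  pos : ∀ h, 0 < lam h
  homothety : ∀ h : H, g.PullbackEqSq (fun p : M ↦ h • p) (lam h)

/-- `(M, g₀, H, lam)` is a `𝔓`-structure with base point `P₀`. -/
structure IsPStructure (g₀ : PseudoRiemannianMetric E M) (lam : H → ℝ) (P₀ : M) : Prop where
  smooth_action : ContMDiffSMul 𝓘(ℝ, F) 𝓘(ℝ, E) ∞ H M
  transitive : MulAction.IsPretransitive H M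
  effective : FaithfulSMul H M
  isometry : ∀ h : H, g₀.PullbackEqSq (fun p : M ↦ h • p) 1
  pos : ∀ h, 0 < lam h
  map_mul : ∀ h k, lam (h * k) = lam h * lam k
  smooth_character : ContMDiff 𝓘(ℝ, F) 𝓘(ℝ, ℝ) ∞ lam
  nontrivial : ∃ h, lam h ≠ 1
  isotropy : ∀ h ∈ MulAction.stabilizer H P₀, lam h = 1

/-- The slice `M_t`: the image of `lam⁻¹{t} / H₀` under the identification `H / H₀ = M` given by
`h ↦ h • P₀`, where `H₀` is the isotropy group of `P₀`. -/
def characterSlice (lam : H → ℝ) (P₀ : M) (t : ℝ) : Set M :=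
  (fun h : H ↦ h • P₀) '' (lam ⁻¹' {t})

/-- `g` is the metric `g_λ` that is equal to `t² g₀` at all points of the slice `M_t`, for
every `t`. -/
def IsRescaling (g₀ : PseudoRiemannianMetric E M) (lam : H → ℝ) (P₀ : M)
    (g : PseudoRiemannianMetric E M) : Prop :=
  ∀ t : ℝ, ∀ p ∈ characterSlice lam P₀ t, g.inner p = t ^ 2 • g₀.inner p

end Action

end

/-! Both directions rest on a positive function `f` on `M` with `f (h • P₀) = lam h` and `f (h • p)
= lam h * f p`; the two metrics are related by `g = f² g₀`, and the factor `f²` absorbs the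
homothety constants exactly.

From `g₀` to `g`, the function exists because `lam` is a homomorphism that is trivial on the
isotropy group (`IsPStructure.exists_potential`). Its smoothness needs smooth local sections of the
orbit map (`exists_orbitMap_section`). The orbit map is open by Baire category, and by equivariance
its rank near the identity does not exceed the rank at the identity. If that rank were less than the
dimension of `M`, a neighbourhood of the identity would be mapped onto a set of too small Hausdorff
dimension, contrary to openness. So the orbit map is a submersion there.

From `g` to `g₀`, the function is read off from a Weyl scalar `w` that does not vanish at some
point. A complete contraction with `r` pairs and `n` factors satisfies `w p = lam h ^ (2 * (r - n))
* w (h • p)`, and `r - n > 0` since each factor has at least four slots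
(`PullbackEqSq.weylScalar_eq`). By transitivity `w` has no zeros, so `f` is the root of order `2 *
(r - n)` of `w P₀ / w`. That `lam` is smooth, multiplicative and trivial on the isotropy group
follows from this formula. The scaling law is computed in charts: a homothety preserves the
Levi-Civita connection, hence multiplies every `∇^k R` by the same power of its constant. -/

set_option maxSynthPendingDepth 3
set_option synthInstance.maxHeartbeats 200000
set_option linter.unusedSectionVars false

/-! ### Christoffel symbols and curvature under homotheties, in coordinates. -/

section CoordinateGeometry

variable {E : Type*} [NormedAddCommGroup E] [NormedSpace ℝ E]

/-- A smooth field of symmetric non-degenerate bilinear forms on the open subset `U` of `E`. -/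
structure IsMetricOn (G : E → E →L[ℝ] E →L[ℝ] ℝ) (U : Set E) : Prop where
  isOpen : IsOpen U
  contDiffOn : ContDiffOn ℝ ∞ G U
  symm : ∀ x ∈ U, ∀ u v, G x u v = G x v u
  nondegenerate : ∀ x ∈ U, ∀ u, (∀ v, G x u v = 0) → u = 0

/-- `τ` maps `(U', G')` to `(U, G)` and multiplies the metric by `c ^ 2`. -/
structure IsHomothetyOn (τ : E → E) (c : ℝ) (G' : E → E →L[ℝ] E →L[ℝ] ℝ) (U' : Set E)
    (G : E → E →L[ℝ] E →L[ℝ] ℝ) (U : Set E) : Prop where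
  contDiffOn : ContDiffOn ℝ ∞ τ U'
  mapsTo : Set.MapsTo τ U' U
  ne_zero : c ≠ 0
  pullback : ∀ y ∈ U', ∀ u v, G (τ y) (fderiv ℝ τ y u) (fderiv ℝ τ y v) = c ^ 2 * G' y u v

/-- The Christoffel symbols of the second kind as a field of continuous bilinear maps. -/
noncomputable def christoffelMap (G : E → E →L[ℝ] E →L[ℝ] ℝ) (x : E) : E →L[ℝ] E →L[ℝ] E :=
  (ContinuousLinearMap.compL ℝ E (E →L[ℝ] ℝ) E (G x).inverse).comp
    ((1 / 2 : ℝ) • (fderiv ℝ G x + (fderiv ℝ G x).flip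
      - ((ContinuousLinearMap.flipₗᵢ ℝ E E ℝ).toContinuousLinearEquiv :
          (E →L[ℝ] E →L[ℝ] ℝ) →L[ℝ] E →L[ℝ] E →L[ℝ] ℝ).comp (fderiv ℝ G x).flip))

theorem christoffelMap_apply (G : E → E →L[ℝ] E →L[ℝ] ℝ) (x u v : E) :
    christoffelMap G x u v = christoffel G x u v := rfl

variable [FiniteDimensional ℝ E]

namespace IsMetricOn

variable {G : E → E →L[ℝ] E →L[ℝ] ℝ} {U : Set E}

/-- `ContinuousLinearMap.inverse` is zero on maps that are not invertible. Non-degeneracy and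
equality of dimensions exclude this default value. -/
theorem exists_equiv (hG : IsMetricOn G U) {x : E} (hx : x ∈ U) :
    ∃ e : E ≃L[ℝ] (E →L[ℝ] ℝ), (e : E →L[ℝ] E →L[ℝ] ℝ) = G x := by
  have hinj : Function.Injective (G x) := by
    rw [injective_iff_map_eq_zero]
    intro u hu
    exact hG.nondegenerate x hx u fun v ↦ by simp [hu]
  have hfin : Module.finrank ℝ E = Module.finrank ℝ (E →L[ℝ] ℝ) := by
    rw [← (LinearMap.toContinuousLinearMap (𝕜 := ℝ) (E := E) (F' := ℝ)).finrank_eq]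
    exact (Subspace.dual_finrank_eq (K := ℝ) (V := E)).symm
  refine ⟨(LinearEquiv.ofInjectiveOfFinrankEq (G x : E →ₗ[ℝ] E →L[ℝ] ℝ) hinj
    hfin).toContinuousLinearEquiv, ?_⟩
  ext u v
  rfl

theorem apply_christoffel (hG : IsMetricOn G U) {x : E} (hx : x ∈ U) (u v w : E) :
    G x (christoffel G x u v) w = (1 / 2 : ℝ) *
      (fderiv ℝ G x u v w + fderiv ℝ G x v u w - fderiv ℝ G x w u v) := by
  obtain ⟨e, he⟩ := hG.exists_equiv hx
  have : G x (christoffel G x u v) = christoffelLower G x u v := by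
    rw [christoffel, ← he, ContinuousLinearMap.inverse_equiv]
    exact e.apply_symm_apply _
  rw [this]
  simp [christoffelLower]

theorem contDiffOn_fderiv (hG : IsMetricOn G U) : ContDiffOn ℝ ∞ (fderiv ℝ G) U :=
  hG.contDiffOn.fderiv_of_isOpen hG.isOpen le_rfl

theorem contDiffOn_christoffelMap (hG : IsMetricOn G U) :
    ContDiffOn ℝ ∞ (christoffelMap G) U := by
  have hinv : ContDiffOn ℝ ∞ (fun x ↦ (G x).inverse) U := by
    intro x hx
    obtain ⟨e, he⟩ := hG.exists_equiv hx
    have h := contDiffAt_map_inverse (𝕜 := ℝ) (n := ∞) e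
    rw [he] at h
    exact h.comp_contDiffWithinAt x (hG.contDiffOn x hx)
  have hD := hG.contDiffOn_fderiv
  have hflip : ContDiffOn ℝ ∞ (fun x ↦ (fderiv ℝ G x).flip) U :=
    ((ContinuousLinearMap.flipₗᵢ ℝ E E (E →L[ℝ] ℝ)).contDiff).comp_contDiffOn hD
  unfold christoffelMap
  refine ContDiffOn.clm_comp ?_ ?_
  · exact (ContinuousLinearMap.contDiff _).comp_contDiffOn hinv
  · exact ((hD.add hflip).sub (contDiffOn_const.clm_comp hflip)).const_smul _

theorem differentiableAt (hG : IsMetricOn G U) {x : E} (hx : x ∈ U) : DifferentiableAt ℝ G x :=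
  (hG.contDiffOn.contDiffAt (hG.isOpen.mem_nhds hx)).differentiableAt (by simp)

theorem differentiableAt_christoffelMap (hG : IsMetricOn G U) {x : E} (hx : x ∈ U) :
    DifferentiableAt ℝ (christoffelMap G) x :=
  (hG.contDiffOn_christoffelMap.contDiffAt (hG.isOpen.mem_nhds hx)).differentiableAt (by simp)

theorem fderiv_christoffel (hG : IsMetricOn G U) {x : E} (hx : x ∈ U) (u v z : E) :
    fderiv ℝ (fun y ↦ christoffel G y v z) x u = fderiv ℝ (christoffelMap G) x u v z := by
  have h := (((hG.differentiableAt_christoffelMap hx).hasFDerivAt.clm_apply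
    (hasFDerivAt_const v x)).clm_apply (hasFDerivAt_const z x)).fderiv
  simp only [christoffelMap_apply] at h
  rw [h]
  simp

end IsMetricOn

namespace IsHomothetyOn

variable {τ : E → E} {c : ℝ} {G' G : E → E →L[ℝ] E →L[ℝ] ℝ} {U' U : Set E}

/-- A kernel vector of the derivative would be orthogonal to everything for `G'`, because `c ≠ 0`.
Thus a homothety is automatically a local diffeomorphism. -/
theorem injective_fderiv (hτ : IsHomothetyOn τ c G' U' G U) (hG' : IsMetricOn G' U')
    {y : E} (hy : y ∈ U') : Function.Injective (fderiv ℝ τ y) := by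
  rw [injective_iff_map_eq_zero]
  intro u hu
  refine hG'.nondegenerate y hy u fun v ↦ ?_
  have h := hτ.pullback y hy u v
  rw [hu] at h
  simpa [hτ.ne_zero] using h.symm

theorem surjective_fderiv (hτ : IsHomothetyOn τ c G' U' G U) (hG' : IsMetricOn G' U')
    {y : E} (hy : y ∈ U') : Function.Surjective (fderiv ℝ τ y) :=
  LinearMap.surjective_of_injective (f := (fderiv ℝ τ y : E →ₗ[ℝ] E)) (hτ.injective_fderiv hG' hy)

theorem contDiffOn_fderiv (hτ : IsHomothetyOn τ c G' U' G U) (hU' : IsOpen U') :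
    ContDiffOn ℝ ∞ (fderiv ℝ τ) U' :=
  hτ.contDiffOn.fderiv_of_isOpen hU' le_rfl

theorem hasFDerivAt (hτ : IsHomothetyOn τ c G' U' G U) (hU' : IsOpen U') {y : E} (hy : y ∈ U') :
    HasFDerivAt τ (fderiv ℝ τ y) y :=
  ((hτ.contDiffOn.contDiffAt (hU'.mem_nhds hy)).differentiableAt (by simp)).hasFDerivAt

theorem hasFDerivAt_fderiv (hτ : IsHomothetyOn τ c G' U' G U) (hU' : IsOpen U')
    {y : E} (hy : y ∈ U') : HasFDerivAt (fderiv ℝ τ) (fderiv ℝ (fderiv ℝ τ) y) y :=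
  (((hτ.contDiffOn_fderiv hU').contDiffAt (hU'.mem_nhds hy)).differentiableAt
    (by simp)).hasFDerivAt

theorem hasFDerivAt_fderiv_fderiv (hτ : IsHomothetyOn τ c G' U' G U) (hU' : IsOpen U')
    {y : E} (hy : y ∈ U') :
    HasFDerivAt (fderiv ℝ (fderiv ℝ τ)) (fderiv ℝ (fderiv ℝ (fderiv ℝ τ)) y) y :=
  ((((hτ.contDiffOn_fderiv hU').fderiv_of_isOpen (n := ∞) (m := ∞) hU' le_rfl).contDiffAt
    (hU'.mem_nhds hy)).differentiableAt (by simp)).hasFDerivAt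

theorem fderiv_fderiv_symm (hτ : IsHomothetyOn τ c G' U' G U) (hU' : IsOpen U') {y : E}
    (hy : y ∈ U') (u v : E) :
    fderiv ℝ (fderiv ℝ τ) y u v = fderiv ℝ (fderiv ℝ τ) y v u := by
  have h := (hτ.contDiffOn.contDiffAt (hU'.mem_nhds hy)).isSymmSndFDerivAt
    (by simpa using ENat.LEInfty.out)
  exact h u v

theorem fderiv_fderiv_fderiv_symm (hτ : IsHomothetyOn τ c G' U' G U) (hU' : IsOpen U') {y : E}
    (hy : y ∈ U') (u v w : E) :
    fderiv ℝ (fderiv ℝ (fderiv ℝ τ)) y u v w = fderiv ℝ (fderiv ℝ (fderiv ℝ τ)) y v u w := by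
  have h := ((hτ.contDiffOn_fderiv hU').contDiffAt (hU'.mem_nhds hy)).isSymmSndFDerivAt
    (by simpa using ENat.LEInfty.out)
  rw [h u v]

theorem fderiv_metric (hτ : IsHomothetyOn τ c G' U' G U) (hG' : IsMetricOn G' U')
    (hG : IsMetricOn G U) {y : E} (hy : y ∈ U') (u v w : E) :
    c ^ 2 * fderiv ℝ G' y u v w =
      fderiv ℝ G (τ y) (fderiv ℝ τ y u) (fderiv ℝ τ y v) (fderiv ℝ τ y w)
      + G (τ y) (fderiv ℝ (fderiv ℝ τ) y u v) (fderiv ℝ τ y w)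
      + G (τ y) (fderiv ℝ τ y v) (fderiv ℝ (fderiv ℝ τ) y u w) := by
  have hτ1 := hτ.hasFDerivAt hG'.isOpen hy
  have hτ2 := hτ.hasFDerivAt_fderiv hG'.isOpen hy
  have h1 := ((((hG.differentiableAt (hτ.mapsTo hy)).hasFDerivAt.comp y hτ1).clm_apply
    (hτ2.clm_apply (hasFDerivAt_const v y))).clm_apply (hτ2.clm_apply (hasFDerivAt_const w y)))
  have h2 := (((hG'.differentiableAt hy).hasFDerivAt.clm_apply
    (hasFDerivAt_const v y)).clm_apply (hasFDerivAt_const w y)).const_mul (c ^ 2)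
  have h3 := h2.congr_of_eventuallyEq
    (f₁ := fun y ↦ G (τ y) (fderiv ℝ τ y v) (fderiv ℝ τ y w))
    (Filter.eventuallyEq_of_mem (hG'.isOpen.mem_nhds hy) fun z hz ↦ hτ.pullback z hz v w)
  have h := DFunLike.congr_fun (h1.unique h3) u
  simp at h
  linarith

/-- The usual transformation law of a connection. The constant `c` drops out, since the Levi-Civita
connection does not see a constant factor in the metric. -/
theorem fderiv_christoffel_eq (hτ : IsHomothetyOn τ c G' U' G U) (hG' : IsMetricOn G' U')
    (hG : IsMetricOn G U) {y : E} (hy : y ∈ U') (u v : E) :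
    fderiv ℝ τ y (christoffel G' y u v) =
      christoffel G (τ y) (fderiv ℝ τ y u) (fderiv ℝ τ y v) + fderiv ℝ (fderiv ℝ τ) y u v := by
  have hy' := hτ.mapsTo hy
  rw [← sub_eq_zero]
  refine hG.nondegenerate _ hy' _ fun w ↦ ?_
  obtain ⟨w, rfl⟩ := hτ.surjective_fderiv hG' hy w
  have hB := hτ.fderiv_fderiv_symm hG'.isOpen hy
  simp only [map_sub, map_add, sub_apply, add_apply,
    hG.apply_christoffel hy', hτ.pullback y hy, hG'.apply_christoffel hy]
  have h1 := hτ.fderiv_metric hG' hG hy u v w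
  have h2 := hτ.fderiv_metric hG' hG hy v u w
  have h3 := hτ.fderiv_metric hG' hG hy w u v
  rw [hB v u] at h2
  rw [hB w u, hB w v, hG.symm _ hy' (fderiv ℝ (fderiv ℝ τ) y u w)] at h3
  rw [hG.symm _ hy' (fderiv ℝ τ y v)] at h1 h3
  rw [hG.symm _ hy' (fderiv ℝ τ y u)] at h2 h3
  rw [← sub_eq_zero] at h1 h2 h3
  -- The Koszul combination of the differentiated pull-back identity: by the symmetry of the second
  -- derivative, only its value on `u, v` survives.
  linear_combination (1 / 2 : ℝ) * h1 + (1 / 2 : ℝ) * h2 - (1 / 2 : ℝ) * h3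

/-- The law for the Christoffel symbols is differentiated once (`key`) and antisymmetrized in `u,
v`; the third derivatives of `τ` then cancel. -/
theorem fderiv_curvatureOperator (hτ : IsHomothetyOn τ c G' U' G U) (hG' : IsMetricOn G' U')
    (hG : IsMetricOn G U) {y : E} (hy : y ∈ U') (u v z : E) :
    fderiv ℝ τ y (curvatureOperator G' y u v z) =
      curvatureOperator G (τ y) (fderiv ℝ τ y u) (fderiv ℝ τ y v) (fderiv ℝ τ y z) := by
  have hy' := hτ.mapsTo hy
  have hτ1 := hτ.hasFDerivAt hG'.isOpen hy
  have hτ2 := hτ.hasFDerivAt_fderiv hG'.isOpen hy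
  have hτ3 := hτ.hasFDerivAt_fderiv_fderiv hG'.isOpen hy
  have hB := hτ.fderiv_fderiv_symm hG'.isOpen hy
  have hC := hτ.fderiv_fderiv_fderiv_symm hG'.isOpen hy
  have hΓ := hτ.fderiv_christoffel_eq hG' hG hy
  have key : ∀ u v, fderiv ℝ (fderiv ℝ τ) y u (christoffel G' y v z)
      + fderiv ℝ τ y (fderiv ℝ (christoffelMap G') y u v z)
      = fderiv ℝ (christoffelMap G) (τ y) (fderiv ℝ τ y u) (fderiv ℝ τ y v) (fderiv ℝ τ y z)
        + christoffelMap G (τ y) (fderiv ℝ (fderiv ℝ τ) y u v) (fderiv ℝ τ y z)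
        + christoffelMap G (τ y) (fderiv ℝ τ y v) (fderiv ℝ (fderiv ℝ τ) y u z)
        + fderiv ℝ (fderiv ℝ (fderiv ℝ τ)) y u v z := by
    intro u v
    have h1 := hτ2.clm_apply (((hG'.differentiableAt_christoffelMap hy).hasFDerivAt.clm_apply
      (hasFDerivAt_const v y)).clm_apply (hasFDerivAt_const z y))
    have h2 := ((((hG.differentiableAt_christoffelMap hy').hasFDerivAt.comp y hτ1).clm_apply
      (hτ2.clm_apply (hasFDerivAt_const v y))).clm_apply
        (hτ2.clm_apply (hasFDerivAt_const z y))).add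
      ((hτ3.clm_apply (hasFDerivAt_const v y)).clm_apply (hasFDerivAt_const z y))
    have h3 := h2.congr_of_eventuallyEq
      (f₁ := fun y ↦ fderiv ℝ τ y (christoffelMap G' y v z))
      (Filter.eventuallyEq_of_mem (hG'.isOpen.mem_nhds hy) fun x hx ↦
        hτ.fderiv_christoffel_eq hG' hG hx v z)
    have h := DFunLike.congr_fun (h1.unique h3) u
    simp [christoffelMap_apply] at h
    simp only [christoffelMap_apply]
    rw [add_comm, h]
    abel
  have k1 := key u v
  have k2 := key v u
  rw [hB v u, hC v u] at k2
  simp only [curvatureOperator, hG.fderiv_christoffel hy', hG'.fderiv_christoffel hy, map_sub,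
    map_add, hΓ]
  simp only [← christoffelMap_apply, map_add] at k1 k2 ⊢
  rw [← sub_eq_zero] at k1 k2 ⊢
  -- The zero on the right becomes the difference of `k1` and `k2`, and only a comparison of terms
  -- remains.
  rw [← sub_eq_zero.2 (k1.trans k2.symm)]
  abel
end IsHomothetyOn

end CoordinateGeometry

/-! ### Covariant derivatives of tensor fields and their naturality. -/

section TensorFields

variable {E : Type*} [NormedAddCommGroup E] [NormedSpace ℝ E] [FiniteDimensional ℝ E]

/-- `T` is a smooth covariant tensor field of rank `k` on the subset `U` of `E`. -/
structure IsTensorFieldOn {k : ℕ} (T : E → (Fin k → E) → ℝ) (U : Set E) : Prop where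
  contDiffOn : ContDiffOn ℝ ∞ (fun p : E × (Fin k → E) ↦ T p.1 p.2) (U ×ˢ Set.univ)
  linear : ∀ x ∈ U, ∀ (v : Fin k → E) (i : Fin k),
    IsLinearMap ℝ fun z ↦ T x (Function.update v i z)

namespace IsTensorFieldOn

variable {k : ℕ} {T : E → (Fin k → E) → ℝ} {U : Set E}

theorem differentiableAt (hT : IsTensorFieldOn T U) (hU : IsOpen U) {x : E} (hx : x ∈ U)
    (v : Fin k → E) : DifferentiableAt ℝ (fun p : E × (Fin k → E) ↦ T p.1 p.2) (x, v) :=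
  (hT.contDiffOn.contDiffAt ((hU.prod isOpen_univ).mem_nhds ⟨hx, trivial⟩)).differentiableAt
    (by simp)

theorem exists_multilinear (hT : IsTensorFieldOn T U) {x : E} (hx : x ∈ U) :
    ∃ m : ContinuousMultilinearMap ℝ (fun _ : Fin k ↦ E) ℝ, ∀ v, m v = T x v := by
  refine ⟨⟨MultilinearMap.mk' (T x) (fun v i y z ↦ (hT.linear x hx v i).map_add y z)
    (fun v i c z ↦ (hT.linear x hx v i).map_smul c z), ?_⟩, fun v ↦ rfl⟩
  exact hT.contDiffOn.continuousOn.comp_continuous (f := fun v : Fin k → E ↦ (x, v))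
    (by fun_prop) (fun v ↦ ⟨hx, trivial⟩)

/-- By multilinearity the correction terms are a derivative of `T` in its arguments. The whole
covariant derivative is thus one derivative on `E × (Fin k → E)`, along the horizontal lift of `v
0`; smoothness and naturality reduce to the chain rule. -/
theorem covariantDerivative_eq (hT : IsTensorFieldOn T U) (hU : IsOpen U)
    (G : E → E →L[ℝ] E →L[ℝ] ℝ) {x : E} (hx : x ∈ U) (v : Fin (k + 1) → E) :
    covariantDerivative G T x v = fderiv ℝ (fun p : E × (Fin k → E) ↦ T p.1 p.2) (x, Fin.tail v)
      (v 0, fun s ↦ -christoffel G x (v 0) (Fin.tail v s)) := by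
  have hd := (hT.differentiableAt hU hx (Fin.tail v)).hasFDerivAt
  have h1 := (hd.comp x (f := fun y ↦ (y, Fin.tail v))
    ((hasFDerivAt_id x).prodMk (hasFDerivAt_const (Fin.tail v) x))).fderiv
  have h2 := hd.comp (Fin.tail v) (f := fun w ↦ (x, w))
    ((hasFDerivAt_const x (Fin.tail v)).prodMk (hasFDerivAt_id (Fin.tail v)))
  obtain ⟨m, hm⟩ := hT.exists_multilinear hx
  have h3 := m.hasFDerivAt (Fin.tail v)
  have h4 := DFunLike.congr_fun (h2.unique (h3.congr_of_eventuallyEq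
    (.of_forall fun w ↦ (hm w).symm)))
    (fun s ↦ -christoffel G x (v 0) (Fin.tail v s))
  have h5 : fderiv ℝ (fun y ↦ T y (Fin.tail v)) x (v 0)
      = fderiv ℝ (fun p : E × (Fin k → E) ↦ T p.1 p.2) (x, Fin.tail v) (v 0, 0) := by
    have := DFunLike.congr_fun h1 (v 0)
    simpa [Function.comp_def] using this
  have h6 : ((v 0, fun s ↦ -christoffel G x (v 0) (Fin.tail v s)) : E × (Fin k → E))
      = (v 0, 0) + (0, fun s ↦ -christoffel G x (v 0) (Fin.tail v s)) := by simp
  rw [h6, map_add, ← h5, covariantDerivative, sub_eq_add_neg]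
  congr 1
  simp only [ContinuousLinearMap.comp_apply, ContinuousLinearMap.prod_apply, zero_apply,
    ContinuousLinearMap.id_apply, ContinuousMultilinearMap.linearDeriv_apply] at h4
  rw [h4, ← Finset.sum_neg_distrib]
  refine Finset.sum_congr rfl fun s _ ↦ ?_
  rw [hm]
  exact ((hT.linear x hx (Fin.tail v) s).map_neg _).symm

theorem covariantDerivative {G : E → E →L[ℝ] E →L[ℝ] ℝ} (hT : IsTensorFieldOn T U)
    (hG : IsMetricOn G U) : IsTensorFieldOn (covariantDerivative G T) U where
  contDiffOn := by
    have hD := hT.contDiffOn.fderiv_of_isOpen (m := ∞) (hG.isOpen.prod isOpen_univ) le_rfl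
    have htail : ContDiff ℝ ∞ (fun p : E × (Fin (k + 1) → E) ↦ (p.1, Fin.tail p.2)) := by
      unfold Fin.tail
      fun_prop
    have hD' := hD.comp (s := U ×ˢ (Set.univ : Set (Fin (k + 1) → E))) htail.contDiffOn
      (fun p hp ↦ ⟨hp.1, trivial⟩)
    have hΓ : ContDiffOn ℝ ∞ (fun p : E × (Fin (k + 1) → E) ↦ christoffelMap G p.1)
        (U ×ˢ Set.univ) :=
      hG.contDiffOn_christoffelMap.comp contDiff_fst.contDiffOn (fun p hp ↦ hp.1)
    have h0 : ∀ i, ContDiffOn ℝ ∞ (fun p : E × (Fin (k + 1) → E) ↦ p.2 i) (U ×ˢ Set.univ) :=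
      fun i ↦ ContDiff.contDiffOn (by fun_prop)
    refine (hD'.clm_apply ((h0 0).prodMk (contDiffOn_pi.2 fun s ↦
      ((hΓ.clm_apply (h0 0)).clm_apply (h0 s.succ)).neg))).congr fun p hp ↦ ?_
    exact hT.covariantDerivative_eq hG.isOpen G hp.1 p.2
  linear := by
    intro x hx v i
    refine Fin.cases ?_ (fun j ↦ ?_) i
    · simp only [hT.covariantDerivative_eq hG.isOpen G hx, Fin.tail_update_zero,
        Function.update_self]
      have : ∀ z, ((z, fun s ↦ -christoffel G x z (Fin.tail v s)) : E × (Fin k → E))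
          = ((ContinuousLinearMap.id ℝ E).prod
            (ContinuousLinearMap.pi fun s ↦ -(christoffelMap G x).flip (Fin.tail v s))) z := by
        intro z
        simp [christoffelMap_apply]
      simp only [this]
      exact ((fderiv ℝ (fun p : E × (Fin k → E) ↦ T p.1 p.2) (x, Fin.tail v)).comp
        _).toLinearMap.isLinear
    · -- the covariant derivative is the derivative of `T` along parallel vector fields
      let L : E → E →L[ℝ] E := fun y ↦ .id ℝ E - christoffelMap G x (y - x)
      let f : E → E → ℝ := fun z y ↦ T y (Function.update (fun s ↦ L y (Fin.tail v s)) j (L y z))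
      have hf : ∀ z, HasFDerivAt (f z)
          ((fderiv ℝ (fun p : E × (Fin k → E) ↦ T p.1 p.2)
              (x, Function.update (Fin.tail v) j z)).comp
            ((ContinuousLinearMap.id ℝ E).prod (ContinuousLinearMap.pi fun s ↦
              -(christoffelMap G x).flip (Function.update (Fin.tail v) j z s)))) x := by
        intro z
        have hL : ∀ w, HasFDerivAt (fun y ↦ L y w) (-(christoffelMap G x).flip w) x := by
          intro w
          have h := (((christoffelMap G x).flip w).hasFDerivAt (x := x - x)).comp x
            (f := fun y ↦ y - x) ((hasFDerivAt_id x).sub_const x)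
          have := h.const_sub w
          simpa [L, Function.comp_def] using this
        have hp := (hasFDerivAt_id x).prodMk (hasFDerivAt_pi.2 fun s ↦
          hL (Function.update (Fin.tail v) j z s))
        have hx0 : (id x, fun s ↦ L x (Function.update (Fin.tail v) j z s))
            = (x, Function.update (Fin.tail v) j z) := by
          simp [L]
        have hd := (hT.differentiableAt hG.isOpen hx (Function.update (Fin.tail v) j z)).hasFDerivAt
        rw [← hx0] at hd
        have := hd.comp x hp
        rw [hx0] at this
        refine this.congr_of_eventuallyEq (.of_forall fun y ↦ ?_)
        simp only [f, Function.comp_def, id]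
        congr 1
        ext s
        by_cases hs : s = j
        · subst hs; simp
        · simp [hs]
      have hcov : ∀ z, _root_.covariantDerivative G T x (Function.update v j.succ z)
          = fderiv ℝ (f z) x (v 0) := by
        intro z
        rw [hT.covariantDerivative_eq hG.isOpen G hx, (hf z).fderiv, Fin.tail_update_succ,
          Function.update_of_ne (Fin.succ_ne_zero j).symm]
        simp only [ContinuousLinearMap.comp_apply]
        congr 1
      -- Every `L y` is linear, so linearity in `z` holds for all `y` near `x` and passes to the
      -- derivative at `x`.
      have hlin : ∀ y ∈ U, IsLinearMap ℝ fun z ↦ f z y := by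
        intro y hy
        have h := hT.linear y hy (fun s ↦ L y (Fin.tail v s)) j
        exact ⟨fun a b ↦ by simpa [f] using h.map_add (L y a) (L y b),
          fun a b ↦ by simpa [f] using h.map_smul a (L y b)⟩
      simp only [hcov]
      constructor
      · intro a b
        have h := ((hf (a + b)).unique (((hf a).add (hf b)).congr_of_eventuallyEq
          (Filter.eventuallyEq_of_mem (hG.isOpen.mem_nhds hx)
            fun y hy ↦ (hlin y hy).map_add a b)))
        rw [(hf (a + b)).fderiv, h, (hf a).fderiv, (hf b).fderiv]
        rfl
      · intro a b
        have h := ((hf (a • b)).unique (((hf b).const_smul a).congr_of_eventuallyEq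
          (Filter.eventuallyEq_of_mem (hG.isOpen.mem_nhds hx)
            fun y hy ↦ (hlin y hy).map_smul a b)))
        rw [(hf (a • b)).fderiv, h, (hf b).fderiv]
        rfl

end IsTensorFieldOn

/-- The map `(y, w) ↦ (τ y, Dτ w)` sends horizontal lifts to horizontal lifts: the second derivative
of `τ` cancels against the one in `fderiv_christoffel_eq`. -/
theorem IsHomothetyOn.covariantDerivative_eq {τ : E → E} {c : ℝ}
    {G' G : E → E →L[ℝ] E →L[ℝ] ℝ} {U' U : Set E} (hτ : IsHomothetyOn τ c G' U' G U)
    (hG' : IsMetricOn G' U') (hG : IsMetricOn G U) {k : ℕ} {T' T : E → (Fin k → E) → ℝ}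
    (hT' : IsTensorFieldOn T' U') (hT : IsTensorFieldOn T U) {μ : ℝ}
    (h : ∀ y ∈ U', ∀ v, T' y v = μ * T (τ y) (fun s ↦ fderiv ℝ τ y (v s)))
    {y : E} (hy : y ∈ U') (v : Fin (k + 1) → E) :
    covariantDerivative G' T' y v =
      μ * covariantDerivative G T (τ y) (fun s ↦ fderiv ℝ τ y (v s)) := by
  rw [hT'.covariantDerivative_eq hG'.isOpen G' hy,
    hT.covariantDerivative_eq hG.isOpen G (hτ.mapsTo hy)]
  set w := Fin.tail v
  have hw : Fin.tail (fun s ↦ fderiv ℝ τ y (v s)) = fun s ↦ fderiv ℝ τ y (w s) := rfl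
  rw [hw]
  have hfst : HasFDerivAt (Prod.fst : E × (Fin k → E) → E) (ContinuousLinearMap.fst ℝ _ _)
    (y, w) := hasFDerivAt_fst
  have hsnd : ∀ s, HasFDerivAt (fun p : E × (Fin k → E) ↦ p.2 s)
      ((ContinuousLinearMap.proj (R := ℝ) (φ := fun _ : Fin k ↦ E) s).comp
        (ContinuousLinearMap.snd ℝ E (Fin k → E))) (y, w) :=
    fun s ↦ ((ContinuousLinearMap.proj (R := ℝ) (φ := fun _ : Fin k ↦ E) s).comp
      (ContinuousLinearMap.snd ℝ E (Fin k → E))).hasFDerivAt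
  have hτ1 := (hτ.hasFDerivAt hG'.isOpen hy).comp (y, w) hfst
  have hτ2 := (hτ.hasFDerivAt_fderiv hG'.isOpen hy).comp (y, w) hfst
  have hp := hτ1.prodMk (hasFDerivAt_pi.2 fun s ↦ hτ2.clm_apply (hsnd s))
  have hd := ((hT.differentiableAt hG.isOpen (hτ.mapsTo hy)
    (fun s ↦ fderiv ℝ τ y (w s))).hasFDerivAt.comp (y, w) hp).const_mul μ
  have hd' := (hT'.differentiableAt hG'.isOpen hy w).hasFDerivAt
  have key := hd'.unique (hd.congr_of_eventuallyEq (Filter.eventuallyEq_of_mem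
    ((hG'.isOpen.prod isOpen_univ).mem_nhds ⟨hy, trivial⟩) fun p hp ↦ h p.1 hp.1 p.2))
  rw [key]
  simp only [smul_apply, ContinuousLinearMap.comp_apply, smul_eq_mul]
  congr 2
  refine Prod.ext ?_ ?_
  · simp
  · funext s
    simp only [ContinuousLinearMap.prod_apply, ContinuousLinearMap.pi_apply, add_apply,
      ContinuousLinearMap.comp_apply, ContinuousLinearMap.flip_apply,
      ContinuousLinearMap.proj_apply, ContinuousLinearMap.coe_fst', ContinuousLinearMap.coe_snd',
      Function.comp_apply, map_neg, hτ.fderiv_christoffel_eq hG' hG hy]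
    abel

namespace IsMetricOn

variable {G : E → E →L[ℝ] E →L[ℝ] ℝ} {U : Set E}

theorem curvatureOperator_eq (hG : IsMetricOn G U) {x : E} (hx : x ∈ U) (u v z : E) :
    curvatureOperator G x u v z =
      fderiv ℝ (christoffelMap G) x u v z - fderiv ℝ (christoffelMap G) x v u z
      + christoffelMap G x u (christoffelMap G x v z)
      - christoffelMap G x v (christoffelMap G x u z) := by
  simp only [curvatureOperator, hG.fderiv_christoffel hx, christoffelMap_apply]

theorem isTensorFieldOn_nablaCurvature (hG : IsMetricOn G U) (k : ℕ) :
    IsTensorFieldOn (nablaCurvature G k) U := by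
  induction k with
  | zero =>
    constructor
    · have hD := hG.contDiffOn_christoffelMap.fderiv_of_isOpen (m := ∞) hG.isOpen le_rfl
      have hfst : ContDiffOn ℝ ∞ (fun p : E × (Fin 4 → E) ↦ p.1) (U ×ˢ Set.univ) :=
        contDiff_fst.contDiffOn
      have hmap : Set.MapsTo (fun p : E × (Fin 4 → E) ↦ p.1) (U ×ˢ Set.univ) U :=
        fun p hp ↦ hp.1
      have hD' := hD.comp hfst hmap
      have hΓ := hG.contDiffOn_christoffelMap.comp hfst hmap
      have hG0 := hG.contDiffOn.comp hfst hmap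
      have h0 : ∀ i, ContDiffOn ℝ ∞ (fun p : E × (Fin 4 → E) ↦ p.2 i) (U ×ˢ Set.univ) :=
        fun i ↦ ContDiff.contDiffOn (by fun_prop)
      have hR := ((((hD'.clm_apply (h0 0)).clm_apply (h0 1)).clm_apply (h0 2)).sub
        (((hD'.clm_apply (h0 1)).clm_apply (h0 0)).clm_apply (h0 2))).add
        ((hΓ.clm_apply (h0 0)).clm_apply ((hΓ.clm_apply (h0 1)).clm_apply (h0 2))) |>.sub
        ((hΓ.clm_apply (h0 1)).clm_apply ((hΓ.clm_apply (h0 0)).clm_apply (h0 2)))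
      refine ((hG0.clm_apply hR).clm_apply (h0 3)).congr fun p hp ↦ ?_
      simp only [nablaCurvature]
      rw [hG.curvatureOperator_eq hp.1]
      rfl
    · intro x hx v i
      simp only [nablaCurvature, hG.curvatureOperator_eq hx]
      fin_cases i <;> constructor <;> intros <;> simp [Function.update] <;> ring
  | succ k ih => exact ih.covariantDerivative hG

end IsMetricOn

/-- The factor arises once, from lowering the last index of the curvature; covariant differentiation
does not change it, so it is the same for all `k`. -/
theorem IsHomothetyOn.nablaCurvature_eq {τ : E → E} {c : ℝ}
    {G' G : E → E →L[ℝ] E →L[ℝ] ℝ} {U' U : Set E} (hτ : IsHomothetyOn τ c G' U' G U)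
    (hG' : IsMetricOn G' U') (hG : IsMetricOn G U) (k : ℕ) {y : E} (hy : y ∈ U')
    (v : Fin (4 + k) → E) :
    nablaCurvature G' k y v =
      (c ^ 2)⁻¹ * nablaCurvature G k (τ y) (fun s ↦ fderiv ℝ τ y (v s)) := by
  induction k generalizing y with
  | zero =>
    simp only [nablaCurvature]
    rw [← hτ.fderiv_curvatureOperator hG' hG hy, hτ.pullback y hy,
      inv_mul_cancel_left₀ (pow_ne_zero 2 hτ.ne_zero)]
  | succ k ih =>
    exact hτ.covariantDerivative_eq hG' hG (hG'.isTensorFieldOn_nablaCurvature k)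
      (hG.isTensorFieldOn_nablaCurvature k) (fun y hy v ↦ ih hy v) hy v

end TensorFields

/-! ### Scaling and smoothness of complete contractions. -/

section Contraction

theorem Fintype.prod_sum_eq_sum_prod {ι κ R : Type*} [Fintype ι] [DecidableEq ι] [Fintype κ]
    [CommSemiring R] (f : ι → κ → R) : ∏ i, ∑ j, f i j = ∑ a : ι → κ, ∏ i, f i (a i) := by
  rw [Finset.prod_univ_sum, Fintype.piFinset_univ]

/-- Expansion of a product of multilinear forms whose arguments are linear combinations. -/
theorem prod_multilinear_sum {E ι α : Type*} [AddCommGroup E] [Module ℝ E] [Fintype ι]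
    [DecidableEq ι] [Fintype α] {κ : ι → Type*} [∀ i, Fintype (κ i)] [∀ i, DecidableEq (κ i)]
    (T : ∀ i, MultilinearMap ℝ (fun _ : κ i ↦ E) ℝ) (A : (Σ i, κ i) → α → ℝ) (e : α → E) :
    ∏ i, T i (fun s ↦ ∑ a, A ⟨i, s⟩ a • e a) =
      ∑ d : (Σ i, κ i) → α, (∏ σ, A σ (d σ)) * ∏ i, T i (fun s ↦ e (d ⟨i, s⟩)) := by
  have h : ∀ i, T i (fun s ↦ ∑ a, A ⟨i, s⟩ a • e a) =
      ∑ r : κ i → α, (∏ s, A ⟨i, s⟩ (r s)) * T i (fun s ↦ e (r s)) := by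
    intro i
    rw [MultilinearMap.map_sum]
    refine Finset.sum_congr rfl fun r _ ↦ ?_
    rw [MultilinearMap.map_smul_univ, smul_eq_mul]
  simp_rw [h]
  rw [Finset.prod_univ_sum, Fintype.piFinset_univ,
    ← (Equiv.piCurry (fun (i : ι) (_ : κ i) ↦ α)).sum_comp]
  refine Finset.sum_congr rfl fun d _ ↦ ?_
  rw [Finset.prod_mul_distrib, Fintype.prod_sigma]
  rfl

/-- The behaviour of a complete contraction under a linear change of coordinates. -/
theorem sum_contraction_change {κ : Type*} [Fintype κ] {r : ℕ} (A g' g : Matrix κ κ ℝ) (t μ : ℝ)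
    (P : (Fin r → κ) → (Fin r → κ) → ℝ)
    (h : ∀ a b, ∑ a', ∑ b', A a a' * A b b' * g' a' b' = t * g a b) :
    ∑ a' : Fin r → κ, ∑ b' : Fin r → κ, (∏ j, g' (a' j) (b' j)) *
        (μ * ∑ a, ∑ b, (∏ j, A (a j) (a' j)) * (∏ j, A (b j) (b' j)) * P a b)
      = μ * t ^ r * ∑ a, ∑ b, (∏ j, g (a j) (b j)) * P a b := by
  have hprod : ∀ a b : Fin r → κ, ∑ a' : Fin r → κ, ∑ b' : Fin r → κ,
      ∏ j, A (a j) (a' j) * A (b j) (b' j) * g' (a' j) (b' j) = t ^ r * ∏ j, g (a j) (b j) := by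
    intro a b
    have h1 : ∏ j, ∑ a', ∑ b', A (a j) a' * A (b j) b' * g' a' b' =
        ∑ a' : Fin r → κ, ∑ b' : Fin r → κ,
          ∏ j, A (a j) (a' j) * A (b j) (b' j) * g' (a' j) (b' j) := by
      rw [Fintype.prod_sum_eq_sum_prod]
      exact Finset.sum_congr rfl fun a' _ ↦ Fintype.prod_sum_eq_sum_prod _
    rw [← h1]
    simp only [h, Finset.prod_mul_distrib, Finset.prod_const, Finset.card_univ, Fintype.card_fin]
  calc _ = ∑ a' : Fin r → κ, ∑ b' : Fin r → κ, ∑ a, ∑ b,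
          μ * ((∏ j, A (a j) (a' j) * A (b j) (b' j) * g' (a' j) (b' j)) * P a b) := by
        simp only [Finset.mul_sum, Finset.prod_mul_distrib]
        refine Finset.sum_congr rfl fun a' _ ↦ Finset.sum_congr rfl fun b' _ ↦
          Finset.sum_congr rfl fun a _ ↦ Finset.sum_congr rfl fun b _ ↦ ?_
        ring
    _ = ∑ a, ∑ b, ∑ a' : Fin r → κ, ∑ b' : Fin r → κ,
          μ * ((∏ j, A (a j) (a' j) * A (b j) (b' j) * g' (a' j) (b' j)) * P a b) := by
        rw [Finset.sum_congr rfl fun a' _ ↦ Finset.sum_comm, Finset.sum_comm]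
        refine Finset.sum_congr rfl fun a _ ↦ ?_
        rw [Finset.sum_congr rfl fun a' _ ↦ Finset.sum_comm, Finset.sum_comm]
    _ = _ := by
        simp only [← Finset.mul_sum, ← Finset.sum_mul, hprod]
        rw [mul_assoc]
        congr 1
        simp only [Finset.mul_sum, mul_assoc]

/-- Counting slots: each factor has at least four, and there are twice as many slots as pairs. -/
theorem WeylContraction.two_mul_factors_le (c : WeylContraction) : 2 * c.factors ≤ c.pairs := by
  have h := Fintype.card_congr c.pairing
  simp only [Fintype.card_sigma, Fintype.card_fin, Fintype.card_sum, Finset.sum_add_distrib,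
    Finset.sum_const, Finset.card_univ, smul_eq_mul] at h
  omega

theorem WeylContraction.pairs_sub_factors_pos (c : WeylContraction) :
    0 < c.pairs - c.factors := by
  have := c.two_mul_factors_le
  have := c.factors_pos
  omega

variable {E : Type*} [NormedAddCommGroup E] [NormedSpace ℝ E] [FiniteDimensional ℝ E]

theorem IsHomothetyOn.inverse_gram_eq {τ : E → E} {c : ℝ}
    {G' G : E → E →L[ℝ] E →L[ℝ] ℝ} {U' U : Set E} (hτ : IsHomothetyOn τ c G' U' G U)
    (hG' : IsMetricOn G' U') {y : E} (hy : y ∈ U')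
    {ι : Type*} [Fintype ι] [DecidableEq ι] (e : Module.Basis ι ℝ E) (a b : ι) :
    ∑ a', ∑ b', LinearMap.toMatrix e e (fderiv ℝ τ y) a a'
      * LinearMap.toMatrix e e (fderiv ℝ τ y) b b'
      * (Matrix.of fun i j ↦ G' y (e i) (e j))⁻¹ a' b'
      = c ^ 2 * (Matrix.of fun i j ↦ G (τ y) (e i) (e j))⁻¹ a b := by
  set A := LinearMap.toMatrix e e (fderiv ℝ τ y) with hA
  set g' : Matrix ι ι ℝ := Matrix.of fun i j ↦ G' y (e i) (e j) with hg'
  set g : Matrix ι ι ℝ := Matrix.of fun i j ↦ G (τ y) (e i) (e j) with hg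
  have hc : c ^ 2 ≠ 0 := pow_ne_zero 2 hτ.ne_zero
  have hAe : ∀ i, fderiv ℝ τ y (e i) = ∑ j, A j i • e j := fun i ↦ by
    have h := e.sum_repr (fderiv ℝ τ y (e i))
    rw [← h]
    simp [hA, LinearMap.toMatrix_apply]
  have hunit : IsUnit A := by
    have h : IsUnit (fderiv ℝ τ y : E →ₗ[ℝ] E) :=
      (Module.End.isUnit_iff _).2 ⟨hτ.injective_fderiv hG' hy, hτ.surjective_fderiv hG' hy⟩
    exact h.map (LinearMap.toMatrixAlgEquiv e)
  have hdet : IsUnit A.det := (Matrix.isUnit_iff_isUnit_det A).1 hunit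
  have hdetT : IsUnit A.transpose.det := by rwa [Matrix.det_transpose]
  have hgram : g' = (c ^ 2)⁻¹ • (A.transpose * g * A) := by
    ext i j
    have h := hτ.pullback y hy (e i) (e j)
    rw [hAe, hAe] at h
    simp only [Matrix.smul_apply, Matrix.mul_apply, Matrix.transpose_apply, smul_eq_mul, hg, hg',
      Matrix.of_apply]
    rw [eq_inv_mul_iff_mul_eq₀ hc, ← h]
    simp only [map_sum, map_smul, sum_apply, smul_apply, smul_eq_mul, Finset.sum_mul,
      Finset.mul_sum]
    refine Finset.sum_congr rfl fun k _ ↦ Finset.sum_congr rfl fun l _ ↦ ?_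
    ring
  have hinv : A * g'⁻¹ * A.transpose = c ^ 2 • g⁻¹ := by
    have h1 : g'⁻¹ = c ^ 2 • (A⁻¹ * g⁻¹ * A.transpose⁻¹) := by
      by_cases hgd : IsUnit g.det
      · apply Matrix.inv_eq_right_inv
        rw [hgram, Matrix.smul_mul, Matrix.mul_smul, smul_smul, inv_mul_cancel₀ hc, one_smul]
        calc A.transpose * g * A * (A⁻¹ * g⁻¹ * A.transpose⁻¹)
            = A.transpose * (g * (A * A⁻¹) * g⁻¹) * A.transpose⁻¹ := by
              simp only [Matrix.mul_assoc]
          _ = 1 := by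
              rw [Matrix.mul_nonsing_inv A hdet, Matrix.mul_one, Matrix.mul_nonsing_inv g hgd,
                Matrix.mul_one, Matrix.mul_nonsing_inv _ hdetT]
      -- A singular `g` makes `g'` singular, and both inverses take their default value zero.
      · have hg'd : ¬ IsUnit g'.det := by
          rw [hgram]
          simp only [Matrix.det_smul, Matrix.det_mul, isUnit_iff_ne_zero] at hgd ⊢
          simp only [ne_eq, not_not] at hgd
          simp [hgd]
        rw [Matrix.nonsing_inv_apply_not_isUnit _ hgd, Matrix.nonsing_inv_apply_not_isUnit _ hg'd]
        simp
    rw [h1]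
    simp only [Matrix.mul_smul, Matrix.smul_mul]
    congr 1
    calc A * (A⁻¹ * g⁻¹ * A.transpose⁻¹) * A.transpose
        = (A * A⁻¹) * g⁻¹ * (A.transpose⁻¹ * A.transpose) := by simp only [Matrix.mul_assoc]
      _ = g⁻¹ := by
        rw [Matrix.mul_nonsing_inv A hdet, Matrix.nonsing_inv_mul _ hdetT, Matrix.one_mul,
          Matrix.mul_one]
  have h := congrFun (congrFun hinv a) b
  simp only [Matrix.mul_apply, Matrix.smul_apply, smul_eq_mul, Matrix.transpose_apply,
    Finset.sum_mul] at h
  rw [← h, Finset.sum_comm]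
  refine Finset.sum_congr rfl fun k _ ↦ Finset.sum_congr rfl fun l _ ↦ ?_
  ring

/-- Each pair contributes `c ^ 2` through the inverse metric, and each curvature factor contributes
`(c ^ 2)⁻¹`. -/
theorem IsHomothetyOn.coordValue_eq {τ : E → E} {c : ℝ}
    {G' G : E → E →L[ℝ] E →L[ℝ] ℝ} {U' U : Set E} (hτ : IsHomothetyOn τ c G' U' G U)
    (hG' : IsMetricOn G' U') (hG : IsMetricOn G U) (w : WeylContraction) {y : E} (hy : y ∈ U') :
    w.coordValue G' y = (c ^ 2) ^ (w.pairs - w.factors) * w.coordValue G (τ y) := by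
  have hc : c ^ 2 ≠ 0 := pow_ne_zero 2 hτ.ne_zero
  simp only [WeylContraction.coordValue]
  set e := Module.finBasis ℝ E with he
  set A := LinearMap.toMatrix e e (fderiv ℝ τ y) with hA
  have hinv := hτ.inverse_gram_eq hG' hy e
  set g' := (Matrix.of fun i j ↦ G' y (e i) (e j))⁻¹ with hg'
  set g := (Matrix.of fun i j ↦ G (τ y) (e i) (e j))⁻¹ with hg
  have hAe : ∀ i, fderiv ℝ τ y (e i) = ∑ j, A j i • e j := fun i ↦ by
    have h := e.sum_repr (fderiv ℝ τ y (e i))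
    rw [← h]
    simp [hA, LinearMap.toMatrix_apply]
  choose m hm using fun k ↦
    (hG.isTensorFieldOn_nablaCurvature k).exists_multilinear (hτ.mapsTo hy)
  set P : (Fin w.pairs → Fin (Module.finrank ℝ E)) → (Fin w.pairs → Fin (Module.finrank ℝ E)) → ℝ :=
    fun a b ↦ ∏ i, nablaCurvature G (w.order i) (τ y)
      (fun s ↦ e (Sum.elim a b (w.pairing ⟨i, s⟩))) with hP
  have hexp : ∀ a' b', ∏ i, nablaCurvature G' (w.order i) y
      (fun s ↦ e (Sum.elim a' b' (w.pairing ⟨i, s⟩))) =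
      ((c ^ 2)⁻¹) ^ w.factors *
        ∑ a, ∑ b, (∏ j, A (a j) (a' j)) * (∏ j, A (b j) (b' j)) * P a b := by
    intro a' b'
    simp only [hτ.nablaCurvature_eq hG' hG _ hy, Finset.prod_mul_distrib, Finset.prod_const,
      Finset.card_univ, Fintype.card_fin, hAe]
    congr 1
    simp only [← hm]
    have h := prod_multilinear_sum (fun i ↦ (m (w.order i)).toMultilinearMap)
      (fun σ a ↦ A a (Sum.elim a' b' (w.pairing σ))) e
    refine h.trans ?_
    -- Through the pairing, an assignment of indices to all slots is a pair `a, b` of assignments to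
    -- the two halves.
    rw [← (Equiv.arrowCongr w.pairing (Equiv.refl (Fin (Module.finrank ℝ E)))).symm.sum_comp,
      ← (Equiv.sumArrowEquivProdArrow _ _ _).symm.sum_comp, Fintype.sum_prod_type]
    refine Finset.sum_congr rfl fun a _ ↦ Finset.sum_congr rfl fun b _ ↦ ?_
    congr 1
    · rw [← w.pairing.symm.prod_comp, Fintype.prod_sum_type]
      simp [Equiv.arrowCongr, Equiv.sumArrowEquivProdArrow]
    · simp only [hP, ← hm]
      rfl
  simp_rw [hexp]
  have hsub : (c ^ 2) ^ (w.pairs - w.factors) = ((c ^ 2)⁻¹) ^ w.factors * (c ^ 2) ^ w.pairs := by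
    have hle : w.factors ≤ w.pairs := by have := w.two_mul_factors_le; omega
    rw [pow_sub₀ _ hc hle, inv_pow, mul_comm]
  rw [hsub]
  exact sum_contraction_change A g' g (c ^ 2) _ P hinv

/-- The inverse matrix is smooth by Cramer's rule, as non-degeneracy keeps the Gram determinant away
from zero. -/
theorem IsMetricOn.contDiffOn_coordValue {G : E → E →L[ℝ] E →L[ℝ] ℝ} {U : Set E}
    (hG : IsMetricOn G U) (w : WeylContraction) : ContDiffOn ℝ ∞ (w.coordValue G) U := by
  set e := Module.finBasis ℝ E with he
  have hgram : ∀ i j, ContDiffOn ℝ ∞ (fun x ↦ G x (e i) (e j)) U := fun i j ↦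
    (hG.contDiffOn.clm_apply contDiffOn_const).clm_apply contDiffOn_const
  have hdet_ne : ∀ x ∈ U, (Matrix.of fun i j ↦ G x (e i) (e j)).det ≠ 0 := by
    intro x hx h0
    obtain ⟨v, hv, hv0⟩ := Matrix.exists_vecMul_eq_zero_iff.2 h0
    have hz : ∑ i, v i • e i = 0 := by
      refine hG.nondegenerate x hx _ fun u ↦ ?_
      have : G x (∑ i, v i • e i) = 0 := by
        apply ContinuousLinearMap.coe_injective
        refine e.ext fun j ↦ ?_
        have := congrFun hv0 j
        simpa [Matrix.vecMul, dotProduct] using this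
      rw [this]; rfl
    apply hv
    funext i
    exact Fintype.linearIndependent_iff.1 e.linearIndependent v hz i
  have hdet : ∀ M : E → Matrix (Fin (Module.finrank ℝ E)) (Fin (Module.finrank ℝ E)) ℝ,
      (∀ i j, ContDiffOn ℝ ∞ (fun x ↦ M x i j) U) → ContDiffOn ℝ ∞ (fun x ↦ (M x).det) U := by
    intro M hM
    simp only [Matrix.det_apply']
    exact ContDiffOn.sum fun σ _ ↦ contDiffOn_const.mul (contDiffOn_prod fun i _ ↦ hM _ _)
  have hinv : ∀ i j, ContDiffOn ℝ ∞
      (fun x ↦ (Matrix.of fun i j ↦ G x (e i) (e j))⁻¹ i j) U := by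
    intro i j
    simp only [Matrix.inv_def, Matrix.smul_apply, smul_eq_mul, Ring.inverse_eq_inv']
    refine ((hdet _ hgram).inv hdet_ne).mul ?_
    simp only [Matrix.adjugate_apply]
    refine hdet _ fun k l ↦ ?_
    by_cases hk : k = j
    · subst hk
      simp only [Matrix.updateRow_self]
      exact contDiffOn_const
    · simp only [Matrix.updateRow_ne hk]
      exact hgram k l
  unfold WeylContraction.coordValue
  refine ContDiffOn.sum fun a _ ↦ ContDiffOn.sum fun b _ ↦
    (contDiffOn_prod fun j _ ↦ hinv _ _).mul (contDiffOn_prod fun i _ ↦ ?_)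
  exact (hG.isTensorFieldOn_nablaCurvature (w.order i)).contDiffOn.comp
    (f := fun x ↦ (x, fun s ↦ e (Sum.elim a b (w.pairing ⟨i, s⟩))))
    (contDiffOn_id.prodMk contDiffOn_const) (fun x hx ↦ ⟨hx, trivial⟩)

end Contraction

/-! ### Metrics on manifolds and their Weyl scalars. -/

namespace PseudoRiemannianMetric

variable {E : Type*} [NormedAddCommGroup E] [NormedSpace ℝ E]
  {M : Type*} [TopologicalSpace M] [ChartedSpace E M] [IsManifold 𝓘(ℝ, E) ∞ M]

theorem ext_inner {g₁ g₂ : PseudoRiemannianMetric E M} (h : ∀ p, g₁.inner p = g₂.inner p) :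
    g₁ = g₂ := by
  cases g₁
  cases g₂
  congr
  exact funext h

/-- The product of a metric and a smooth function without zeros. -/
noncomputable def rescale (g : PseudoRiemannianMetric E M) (f : M → ℝ) (hf : ContMDiff 𝓘(ℝ, E) 𝓘(ℝ, ℝ) ∞ f)
    (hf0 : ∀ p, f p ≠ 0) : PseudoRiemannianMetric E M where
  inner p := f p • g.inner p
  symm p v w := by
    change f p * g.inner p v w = f p * g.inner p w v
    rw [g.symm]
  nondegenerate p v hv := by
    refine g.nondegenerate p v fun w ↦ ?_
    have h : f p * g.inner p v w = 0 := hv w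
    exact (mul_eq_zero.1 h).resolve_left (hf0 p)
  contMDiff := hf.smul_section g.contMDiff

/-- The metric at a point as a bilinear form on the model space. -/
noncomputable def modelInner (g : PseudoRiemannianMetric E M) (p : M) : E →L[ℝ] E →L[ℝ] ℝ := g.inner p

theorem modelInner_symm (g : PseudoRiemannianMetric E M) (p : M) (u v : E) :
    g.modelInner p u v = g.modelInner p v u := g.symm p u v

theorem modelInner_nondegenerate (g : PseudoRiemannianMetric E M) (p : M) (u : E)
    (h : ∀ v, g.modelInner p u v = 0) : u = 0 := g.nondegenerate p u h

theorem inChart_apply (g : PseudoRiemannianMetric E M) (p : M) (x u v : E) :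
    g.inChart p x u v = g.modelInner ((extChartAt 𝓘(ℝ, E) p).symm x)
      (mfderiv 𝓘(ℝ, E) 𝓘(ℝ, E) (extChartAt 𝓘(ℝ, E) p).symm x u)
      (mfderiv 𝓘(ℝ, E) 𝓘(ℝ, E) (extChartAt 𝓘(ℝ, E) p).symm x v) := rfl

theorem contMDiffAt_extChartAt_symm (p : M) {x : E} (hx : x ∈ (extChartAt 𝓘(ℝ, E) p).target) :
    ContMDiffAt 𝓘(ℝ, E) 𝓘(ℝ, E) ∞ (extChartAt 𝓘(ℝ, E) p).symm x :=
  (contMDiffOn_extChartAt_symm p x hx).contMDiffAt ((isOpen_extChartAt_target p).mem_nhds hx)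

theorem isInvertible_mfderiv_extChartAt_symm (p : M) {x : E}
    (hx : x ∈ (extChartAt 𝓘(ℝ, E) p).target) :
    (mfderiv 𝓘(ℝ, E) 𝓘(ℝ, E) (extChartAt 𝓘(ℝ, E) p).symm x).IsInvertible := by
  have : IsManifold 𝓘(ℝ, E) 1 M := .of_le (n := ∞) ENat.LEInfty.out
  have h := isInvertible_mfderivWithin_extChartAt_symm (I := 𝓘(ℝ, E)) hx
  rwa [modelWithCornersSelf_coe, Set.range_id, mfderivWithin_univ] at h

theorem contMDiffOn_tangent_extChartAt_symm (p : M) (u : E) :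
    ContMDiffOn 𝓘(ℝ, E) 𝓘(ℝ, E).tangent ∞
      (fun x : E ↦ (⟨(extChartAt 𝓘(ℝ, E) p).symm x,
        mfderiv 𝓘(ℝ, E) 𝓘(ℝ, E) (extChartAt 𝓘(ℝ, E) p).symm x u⟩ : TangentBundle 𝓘(ℝ, E) M))
      (extChartAt 𝓘(ℝ, E) p).target := by
  have : IsManifold 𝓘(ℝ, E) 1 M := .of_le (n := ∞) ENat.LEInfty.out
  have hopen := isOpen_extChartAt_target (I := 𝓘(ℝ, E)) p
  have h := (contMDiffOn_extChartAt_symm (I := 𝓘(ℝ, E)) (n := ∞) p).contMDiffOn_tangentMapWithin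
    (m := ∞) le_rfl hopen.uniqueMDiffOn
  have hu : ContMDiffOn 𝓘(ℝ, E) 𝓘(ℝ, E).tangent ∞
      (fun x : E ↦ (⟨x, u⟩ : TangentBundle 𝓘(ℝ, E) E)) (extChartAt 𝓘(ℝ, E) p).target :=
    contMDiffOn_vectorSpace_iff_contDiffOn.2 contDiffOn_const
  refine (h.comp hu fun x hx ↦ hx).congr fun x hx ↦ ?_
  simp only [tangentMapWithin, Function.comp_apply]
  rw [mfderivWithin_of_isOpen hopen hx]

theorem contDiffOn_inChart_apply (g : PseudoRiemannianMetric E M) (p : M) (u v : E) :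
    ContDiffOn ℝ ∞ (fun x ↦ g.inChart p x u v) (extChartAt 𝓘(ℝ, E) p).target := by
  rw [← contMDiffOn_iff_contDiffOn]
  intro x hx
  have hg : ContMDiffWithinAt 𝓘(ℝ, E) (𝓘(ℝ, E).prod 𝓘(ℝ, E →L[ℝ] E →L[ℝ] ℝ)) ∞
      (fun y ↦ Bundle.TotalSpace.mk' (E →L[ℝ] E →L[ℝ] ℝ)
        (E := fun p : M ↦ TangentSpace 𝓘(ℝ, E) p →L[ℝ] TangentSpace 𝓘(ℝ, E) p →L[ℝ]
          Bundle.Trivial M ℝ p)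
        ((extChartAt 𝓘(ℝ, E) p).symm y) (g.inner ((extChartAt 𝓘(ℝ, E) p).symm y)))
      (extChartAt 𝓘(ℝ, E) p).target x :=
    (g.contMDiff _).comp_contMDiffWithinAt x (contMDiffOn_extChartAt_symm p x hx)
  have h := ContMDiffWithinAt.clm_bundle_apply₂ (F₁ := E) (F₂ := E) (F₃ := ℝ)
    (E₁ := fun p : M ↦ TangentSpace 𝓘(ℝ, E) p) (E₂ := fun p : M ↦ TangentSpace 𝓘(ℝ, E) p)
    (E₃ := Bundle.Trivial M ℝ) hg
    (contMDiffOn_tangent_extChartAt_symm p u x hx)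
    (contMDiffOn_tangent_extChartAt_symm p v x hx)
  rw [Bundle.contMDiffWithinAt_totalSpace] at h
  exact h.2

variable [FiniteDimensional ℝ E]

theorem isMetricOn_inChart (g : PseudoRiemannianMetric E M) (p : M) :
    IsMetricOn (g.inChart p) (extChartAt 𝓘(ℝ, E) p).target where
  isOpen := isOpen_extChartAt_target p
  contDiffOn := by
    rw [contDiffOn_clm_apply]
    intro u
    rw [contDiffOn_clm_apply]
    exact fun v ↦ g.contDiffOn_inChart_apply p u v
  symm x _ u v := by
    rw [inChart_apply, inChart_apply]
    exact g.modelInner_symm _ _ _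
  nondegenerate x hx u hu := by
    obtain ⟨e, he⟩ : ∃ e : E ≃L[ℝ] E, (e : E →L[ℝ] E)
      = mfderiv 𝓘(ℝ, E) 𝓘(ℝ, E) (extChartAt 𝓘(ℝ, E) p).symm x :=
        isInvertible_mfderiv_extChartAt_symm p hx
    have h0 : e u = 0 := by
      refine g.modelInner_nondegenerate ((extChartAt 𝓘(ℝ, E) p).symm x) (e u) fun w ↦ ?_
      have h := hu (e.symm w)
      rw [inChart_apply, ← he] at h
      exact (congrArg (g.modelInner _ (e u)) (e.apply_symm_apply w)).symm.trans h
    simpa using h0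

theorem _root_.IsMetricOn.mono {G : E → E →L[ℝ] E →L[ℝ] ℝ} {U V : Set E} (hG : IsMetricOn G U)
    (hV : IsOpen V) (hVU : V ⊆ U) : IsMetricOn G V :=
  ⟨hV, hG.contDiffOn.mono hVU, fun x hx ↦ hG.symm x (hVU hx),
    fun x hx ↦ hG.nondegenerate x (hVU hx)⟩

/-- Read in charts, `T` is a homothety of coordinate metrics. The target chart is left free: its
choice at `T p` gives the scaling law, and the case `T = id` gives independence of the chart. -/
theorem PullbackEqSq.coordValue_eq {g : PseudoRiemannianMetric E M} {T : M → M} {c : ℝ}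
    (hT : g.PullbackEqSq T c) (hsmooth : ContMDiff 𝓘(ℝ, E) 𝓘(ℝ, E) ∞ T) (hc : c ≠ 0)
    (w : WeylContraction) {p q : M} (hq : T p ∈ (extChartAt 𝓘(ℝ, E) q).source) :
    g.weylScalar w p = (c ^ 2) ^ (w.pairs - w.factors) *
      w.coordValue (g.inChart q) (extChartAt 𝓘(ℝ, E) q (T p)) := by
  set φ := extChartAt 𝓘(ℝ, E) p with hφ
  set ψ := extChartAt 𝓘(ℝ, E) q with hψ
  have hTφ : ContMDiffOn 𝓘(ℝ, E) 𝓘(ℝ, E) ∞ (fun x ↦ T (φ.symm x)) φ.target :=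
    hsmooth.comp_contMDiffOn (contMDiffOn_extChartAt_symm p)
  set U := φ.target ∩ (fun x ↦ T (φ.symm x)) ⁻¹' ψ.source with hU
  have hUo : IsOpen U := hTφ.continuousOn.isOpen_inter_preimage (isOpen_extChartAt_target p)
    (isOpen_extChartAt_source q)
  set τ : E → E := fun x ↦ ψ (T (φ.symm x)) with hτ
  have hτs : ContMDiffOn 𝓘(ℝ, E) 𝓘(ℝ, E) ∞ τ U := by
    refine (contMDiffOn_extChartAt (I := 𝓘(ℝ, E)) (x := q)).comp
      (hTφ.mono Set.inter_subset_left) fun x hx ↦ ?_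
    rw [← extChartAt_source (I := 𝓘(ℝ, E))]
    exact hx.2
  have hmaps : Set.MapsTo τ U ψ.target := fun x hx ↦ ψ.map_source hx.2
  have hhom : IsHomothetyOn τ c (g.inChart p) U (g.inChart q) ψ.target := by
    refine ⟨contMDiffOn_iff_contDiffOn.1 hτs, hmaps, hc, fun y hy u v ↦ ?_⟩
    have hτd : MDifferentiableAt 𝓘(ℝ, E) 𝓘(ℝ, E) τ y :=
      ((hτs y hy).contMDiffAt (hUo.mem_nhds hy)).mdifferentiableAt (by simp)
    have hψd : MDifferentiableAt 𝓘(ℝ, E) 𝓘(ℝ, E) ψ.symm (τ y) :=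
      (contMDiffAt_extChartAt_symm q (hmaps hy)).mdifferentiableAt (by simp)
    have hφd : MDifferentiableAt 𝓘(ℝ, E) 𝓘(ℝ, E) φ.symm y :=
      (contMDiffAt_extChartAt_symm p hy.1).mdifferentiableAt (by simp)
    have hTd : MDifferentiableAt 𝓘(ℝ, E) 𝓘(ℝ, E) T (φ.symm y) :=
      (hsmooth _).mdifferentiableAt (by simp)
    have heq : ψ.symm ∘ τ =ᶠ[nhds y] T ∘ φ.symm :=
      Filter.eventuallyEq_of_mem (hUo.mem_nhds hy) fun x hx ↦ ψ.left_inv hx.2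
    have h1 : ∀ z : E, mfderiv 𝓘(ℝ, E) 𝓘(ℝ, E) ψ.symm (τ y) (fderiv ℝ τ y z)
        = (mfderiv 𝓘(ℝ, E) 𝓘(ℝ, E) T (φ.symm y)
            (mfderiv 𝓘(ℝ, E) 𝓘(ℝ, E) φ.symm y z) : E) := by
      intro z
      have h2 := mfderiv_comp y hψd hτd
      have h3 := mfderiv_comp y hTd hφd
      have h4 := heq.mfderiv_eq (I := 𝓘(ℝ, E)) (I' := 𝓘(ℝ, E))
      rw [mfderiv_eq_fderiv] at h2
      exact (DFunLike.congr_fun h2 z).symm.trans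
        ((DFunLike.congr_fun h4 z).trans (DFunLike.congr_fun h3 z))
    rw [inChart_apply, inChart_apply]
    have h5 : ψ.symm (τ y) = T (φ.symm y) := ψ.left_inv hy.2
    have h6 := hT (φ.symm y) (mfderiv 𝓘(ℝ, E) 𝓘(ℝ, E) φ.symm y u)
      (mfderiv 𝓘(ℝ, E) 𝓘(ℝ, E) φ.symm y v)
    refine Eq.trans ?_ h6
    rw [h1 u, h1 v, h5]
    rfl
  have hpφ : φ p ∈ U := by
    refine ⟨mem_extChartAt_target p, ?_⟩
    rw [Set.mem_preimage, hφ, extChartAt_to_inv]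
    exact hq
  have h := hhom.coordValue_eq ((g.isMetricOn_inChart p).mono hUo Set.inter_subset_left)
    (g.isMetricOn_inChart q) w hpφ
  have hτp : τ (φ p) = ψ (T p) := by
    simp only [hτ, hφ, extChartAt_to_inv]
  rw [hτp] at h
  exact h

theorem PullbackEqSq.weylScalar_eq {g : PseudoRiemannianMetric E M} {T : M → M} {c : ℝ}
    (hT : g.PullbackEqSq T c) (hsmooth : ContMDiff 𝓘(ℝ, E) 𝓘(ℝ, E) ∞ T) (hc : c ≠ 0)
    (w : WeylContraction) (p : M) :
    g.weylScalar w p = (c ^ 2) ^ (w.pairs - w.factors) * g.weylScalar w (T p) :=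
  hT.coordValue_eq hsmooth hc w (mem_extChartAt_source (T p))

theorem pullbackEqSq_id (g : PseudoRiemannianMetric E M) : g.PullbackEqSq id 1 := by
  intro p v w
  simp [mfderiv_id]

/-- `weylScalar` uses a different chart at every point. Chart independence replaces them near `q` by
the single chart at `q`. -/
theorem contMDiff_weylScalar (g : PseudoRiemannianMetric E M) (w : WeylContraction) :
    ContMDiff 𝓘(ℝ, E) 𝓘(ℝ, ℝ) ∞ (g.weylScalar w) := by
  intro q
  have h1 : ContMDiffAt 𝓘(ℝ, E) 𝓘(ℝ, ℝ) ∞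
      (fun p ↦ w.coordValue (g.inChart q) (extChartAt 𝓘(ℝ, E) q p)) q := by
    have h := (g.isMetricOn_inChart q).contDiffOn_coordValue w
    have h2 := h.contDiffAt ((isOpen_extChartAt_target q).mem_nhds (mem_extChartAt_target q))
    exact h2.contMDiffAt.comp q contMDiffAt_extChartAt
  refine h1.congr_of_eventuallyEq (Filter.eventuallyEq_of_mem (extChartAt_source_mem_nhds
    (I := 𝓘(ℝ, E)) q)
    fun p hp ↦ ?_)
  have h := g.pullbackEqSq_id.coordValue_eq contMDiff_id one_ne_zero w (p := p) (q := q) hp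
  simpa using h

end PseudoRiemannianMetric

/-! ### Submersions, and openness versus rank. -/

section ConstantRank

variable {E : Type*} [NormedAddCommGroup E] [NormedSpace ℝ E] [FiniteDimensional ℝ E]
  {F : Type*} [NormedAddCommGroup F] [NormedSpace ℝ F] [FiniteDimensional ℝ F]

/-- A map with surjective derivative at `x₀` is the first component of a smooth coordinate
system around `x₀`. -/
theorem ContDiffAt.exists_coordinates {φ : F → E} {x₀ : F} (hφ : ContDiffAt ℝ ∞ φ x₀)
    (hs : Function.Surjective (fderiv ℝ φ x₀)) :
    ∃ (K : Submodule ℝ F) (e : OpenPartialHomeomorph F (E × K)), x₀ ∈ e.source ∧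
      (∀ x, (e x).1 = φ x) ∧ ContDiffAt ℝ ∞ e.symm (e x₀) := by
  set A := fderiv ℝ φ x₀ with hA
  obtain ⟨B, hB⟩ := A.exists_rightInverse_of_surjective (LinearMap.range_eq_top.2 hs)
  have hBr : Function.RightInverse B A := fun y ↦ DFunLike.congr_fun hB y
  have hd : HasFDerivAt φ A x₀ := (hφ.differentiableAt (by simp)).hasFDerivAt
  let f : F → E × A.ker := fun x ↦ (φ x, A.projKerOfRightInverse B hBr x)
  have hf : ContDiffAt ℝ ∞ f x₀ :=
    hφ.prodMk (A.projKerOfRightInverse B hBr).contDiff.contDiffAt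
  have hf' : HasFDerivAt f
      ((ContinuousLinearEquiv.equivOfRightInverse A B hBr : F ≃L[ℝ] E × A.ker) :
        F →L[ℝ] E × A.ker) x₀ :=
    hd.prodMk (A.projKerOfRightInverse B hBr).hasFDerivAt
  refine ⟨A.ker, hf.toOpenPartialHomeomorph f hf' (by simp),
    hf.mem_toOpenPartialHomeomorph_source hf' (by simp), fun x ↦ rfl, ?_⟩
  exact hf.to_localInverse hf' (by simp)

theorem ContDiffAt.exists_section {φ : F → E} {x₀ : F} (hφ : ContDiffAt ℝ ∞ φ x₀)
    (hs : Function.Surjective (fderiv ℝ φ x₀)) :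
    ∃ s : E → F, ContDiffAt ℝ ∞ s (φ x₀) ∧ s (φ x₀) = x₀ ∧
      ∀ᶠ y in nhds (φ x₀), φ (s y) = y := by
  obtain ⟨K, e, hx₀, he, hsymm⟩ := hφ.exists_coordinates hs
  have hi : ContDiff ℝ ∞ (fun y : E ↦ (y, (e x₀).2)) := by fun_prop
  have hpt : (φ x₀, (e x₀).2) = e x₀ := Prod.ext (he x₀).symm rfl
  refine ⟨fun y ↦ e.symm (y, (e x₀).2), ?_, ?_, ?_⟩
  · rw [← hpt] at hsymm
    exact hsymm.comp (φ x₀) hi.contDiffAt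
  · simp only [hpt, e.left_inv hx₀]
  · have h : ∀ᶠ y in nhds (φ x₀), (y, (e x₀).2) ∈ e.target := by
      refine hi.continuous.continuousAt.eventually_mem ?_
      rw [hpt]
      exact e.open_target.mem_nhds (e.map_source hx₀)
    filter_upwards [h] with y hy
    rw [← he, e.right_inv hy]

/-- A smooth map whose rank is maximal at `x₀` and smaller than the dimension of the target is
not open at `x₀`. -/
theorem ContDiffAt.surjective_fderiv_of_open_of_rank_le {ψ : F → E} {x₀ : F}
    (hψ : ContDiffAt ℝ ∞ ψ x₀)
    (hrank : ∀ᶠ x in nhds x₀,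
      Module.finrank ℝ (fderiv ℝ ψ x).range ≤ Module.finrank ℝ (fderiv ℝ ψ x₀).range)
    (hopen : nhds (ψ x₀) ≤ Filter.map ψ (nhds x₀)) :
    Function.Surjective (fderiv ℝ ψ x₀) := by
  by_contra hns
  set R := (fderiv ℝ ψ x₀).range with hR
  have hRlt : Module.finrank ℝ R < Module.finrank ℝ E := by
    refine Submodule.finrank_lt fun h ↦ hns ?_
    exact LinearMap.range_eq_top.1 h
  -- `P` projects onto the range `R` of the derivative at `x₀`, so `P ∘ ψ` is a submersion there and
  -- supplies coordinates.
  obtain ⟨P, hP⟩ := Submodule.ClosedComplemented.of_finiteDimensional_quotient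
    (p := R) R.closed_of_finiteDimensional
  have hPψ : ∀ {x}, DifferentiableAt ℝ ψ x →
      HasFDerivAt (fun x ↦ P (ψ x)) (P.comp (fderiv ℝ ψ x)) x :=
    fun h ↦ P.hasFDerivAt.comp _ h.hasFDerivAt
  have hψd := hψ.differentiableAt (by simp)
  have hφ : ContDiffAt ℝ ∞ (fun x ↦ P (ψ x)) x₀ := P.contDiff.contDiffAt.comp x₀ hψ
  have hs : Function.Surjective (fderiv ℝ (fun x ↦ P (ψ x)) x₀) := by
    rintro ⟨_, z, rfl⟩
    refine ⟨z, ?_⟩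
    rw [(hPψ hψd).fderiv]
    exact hP ⟨_, z, rfl⟩
  obtain ⟨K, e, hx₀, he, hsymm⟩ := hφ.exists_coordinates hs
  -- the good points in the coordinate space
  have hgood : ∀ᶠ q in nhds (e x₀), q ∈ e.target ∧ ContDiffAt ℝ 1 e.symm q ∧
      ContDiffAt ℝ 1 ψ (e.symm q) ∧
      Module.finrank ℝ (fderiv ℝ ψ (e.symm q)).range ≤ Module.finrank ℝ R := by
    have h1 : ∀ᶠ x in nhds x₀, ContDiffAt ℝ 1 ψ x :=
      (hψ.of_le (by exact_mod_cast le_top)).eventually (by simp)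
    have h2 : Filter.Tendsto e.symm (nhds (e x₀)) (nhds x₀) := by
      have := hsymm.continuousAt.tendsto
      rwa [e.left_inv hx₀] at this
    filter_upwards [e.open_target.mem_nhds (e.map_source hx₀),
      (hsymm.of_le (m := 1) (by exact_mod_cast le_top)).eventually (by simp), h2.eventually h1,
      h2.eventually hrank] with q h1 h2 h3 h4 using ⟨h1, h2, h3, h4⟩
  rw [Metric.eventually_nhds_iff_ball] at hgood
  obtain ⟨ε, hε, hball⟩ := hgood
  rw [← Prod.mk.eta (p := e x₀), ← ball_prod_same] at hball
  set BR := Metric.ball (e x₀).1 ε with hBR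
  set BK := Metric.ball (e x₀).2 ε with hBK
  -- In these coordinates `P ∘ ψ` is the first projection. By the rank bound `P` is injective on the
  -- range of the derivative of `ψ`, so directions killed by `P ∘ ψ` are killed by `ψ`.
  have hker : ∀ q ∈ BR ×ˢ BK, ∀ k : K, fderiv ℝ (fun q ↦ ψ (e.symm q)) q (0, k) = 0 := by
    intro q hq k
    obtain ⟨hqt, hqs, hqψ, hqr⟩ := hball q hq
    have hes := (hqs.differentiableAt (by simp)).hasFDerivAt
    have hψq := (hqψ.differentiableAt (by simp))
    have hcomp := hψq.hasFDerivAt.comp q hes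
    have hfst : (P.comp (fderiv ℝ ψ (e.symm q))).comp (fderiv ℝ e.symm q)
        = ContinuousLinearMap.fst ℝ R K := by
      refine ((hPψ hψq).comp q hes).unique (hasFDerivAt_fst.congr_of_eventuallyEq ?_)
      filter_upwards [e.open_target.mem_nhds hqt] with q' hq'
      rw [Function.comp_apply, ← he, e.right_inv hq']
    have hsurj : Function.Surjective
        ((P : E →ₗ[ℝ] R).domRestrict (fderiv ℝ ψ (e.symm q)).range) := by
      intro r
      refine ⟨⟨_, fderiv ℝ e.symm q (r, 0), rfl⟩, ?_⟩
      exact DFunLike.congr_fun hfst (r, 0)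
    have hinj : Function.Injective
        ((P : E →ₗ[ℝ] R).domRestrict (fderiv ℝ ψ (e.symm q)).range) := by
      have hle := LinearMap.finrank_le_finrank_of_surjective hsurj
      exact (LinearMap.injective_iff_surjective_of_finrank_eq_finrank
        (le_antisymm hqr hle)).2 hsurj
    rw [show (fun q ↦ ψ (e.symm q)) = ψ ∘ e.symm from rfl, hcomp.fderiv]
    have h0 : (⟨_, fderiv ℝ e.symm q (0, k), rfl⟩ : (fderiv ℝ ψ (e.symm q)).range) = 0 := by
      apply hinj
      rw [map_zero]
      exact DFunLike.congr_fun hfst (0, k)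
    exact congrArg Subtype.val h0
  have hconst : ∀ y ∈ BR, ∀ k ∈ BK, ψ (e.symm (y, k)) = ψ (e.symm (y, (e x₀).2)) := by
    intro y hy k hk
    have hd : ∀ k ∈ BK, HasFDerivAt (fun k ↦ ψ (e.symm (y, k))) (0 : K →L[ℝ] E) k := by
      intro k hk
      obtain ⟨-, hqs, hqψ, -⟩ := hball (y, k) ⟨hy, hk⟩
      have h1 := ((hqψ.differentiableAt (by simp)).comp (y, k)
        (hqs.differentiableAt (by simp))).hasFDerivAt
      have h2 := h1.comp k (f := fun k ↦ (y, k))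
        ((hasFDerivAt_const y k).prodMk (hasFDerivAt_id k))
      refine h2.congr_fderiv ?_
      ext z
      exact hker (y, k) ⟨hy, hk⟩ z
    refine (convex_ball (e x₀).2 ε).is_const_of_fderivWithin_eq_zero (𝕜 := ℝ)
      (f := fun k : K ↦ ψ (e.symm (y, k)))
      (fun k hk ↦ (hd k hk).differentiableAt.differentiableWithinAt) (fun k hk ↦ ?_) hk
      (Metric.mem_ball_self hε)
    rw [fderivWithin_of_isOpen Metric.isOpen_ball hk, (hd k hk).fderiv]
  have hσ : ContDiffOn ℝ 1 (fun y ↦ ψ (e.symm (y, (e x₀).2))) BR := by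
    intro y hy
    obtain ⟨-, hqs, hqψ, -⟩ := hball (y, (e x₀).2) ⟨hy, Metric.mem_ball_self hε⟩
    exact ((hqψ.comp (y, (e x₀).2) hqs).comp y (f := fun y ↦ (y, (e x₀).2))
      (contDiffAt_id.prodMk contDiffAt_const)).contDiffWithinAt
  -- Near `x₀` the values of `ψ` are those of a `C¹` map on a ball of `R`, whose dimension is too
  -- small for the image to be a neighbourhood.
  have hdense : Dense ((fun y ↦ ψ (e.symm (y, (e x₀).2))) '' BR)ᶜ := by
    refine hσ.dense_compl_image_of_dimH_lt_finrank (convex_ball _ ε) subset_rfl ?_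
    rw [Real.dimH_of_mem_nhds (Metric.ball_mem_nhds _ hε)]
    exact_mod_cast hRlt
  have hV : e.source ∩ e ⁻¹' (BR ×ˢ BK) ∈ nhds x₀ :=
    Filter.inter_mem (e.open_source.mem_nhds hx₀) ((e.continuousAt hx₀).preimage_mem_nhds
      (prod_mem_nhds (Metric.ball_mem_nhds _ hε) (Metric.ball_mem_nhds _ hε)))
  have himage : ψ '' (e.source ∩ e ⁻¹' (BR ×ˢ BK)) ∈ nhds (ψ x₀) :=
    hopen (Filter.image_mem_map hV)
  obtain ⟨_, ⟨x, ⟨hxs, hxB⟩, rfl⟩, hz⟩ := mem_closure_iff_nhds.1 (hdense (ψ x₀)) _ himage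
  refine hz ⟨(e x).1, hxB.1, ?_⟩
  have h := hconst (e x).1 hxB.1 (e x).2 hxB.2
  rw [Prod.mk.eta, e.left_inv hxs] at h
  exact h.symm

end ConstantRank

/-! ### Local sections of the orbit map. -/

section OrbitMap

variable {E : Type*} [NormedAddCommGroup E] [NormedSpace ℝ E] [FiniteDimensional ℝ E]
  {M : Type*} [TopologicalSpace M] [ChartedSpace E M] [IsManifold 𝓘(ℝ, E) ∞ M] [T2Space M]
  {F : Type*} [NormedAddCommGroup F] [NormedSpace ℝ F] [FiniteDimensional ℝ F]
  {H : Type*} [TopologicalSpace H] [ChartedSpace F H] [Group H] [LieGroup 𝓘(ℝ, F) ∞ H]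
  [SecondCountableTopology H] [MulAction H M]

/-- Baire category: `H` is σ-compact, being second countable and locally compact, and `M` is locally
compact and Hausdorff. -/
theorem isOpenMap_orbitMap [ContMDiffSMul 𝓘(ℝ, F) 𝓘(ℝ, E) ∞ H M]
    [MulAction.IsPretransitive H M] (P₀ : M) : IsOpenMap (fun h : H ↦ h • P₀) := by
  have : LocallyCompactSpace M := ChartedSpace.locallyCompactSpace E M
  have : LocallyCompactSpace H := ChartedSpace.locallyCompactSpace F H
  have : IsTopologicalGroup H := topologicalGroup_of_lieGroup 𝓘(ℝ, F) ∞
  have : ContinuousSMul H M := ContMDiffSMul.continuousSMul (I := 𝓘(ℝ, F)) (I' := 𝓘(ℝ, E)) ∞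
  exact isOpenMap_smul_of_sigmaCompact P₀

/-- The orbit map of a smooth transitive action has smooth local sections. -/
theorem exists_orbitMap_section (hsmul : ContMDiffSMul 𝓘(ℝ, F) 𝓘(ℝ, E) ∞ H M)
    (htrans : MulAction.IsPretransitive H M) (P₀ : M) :
    ∃ S : M → H, ContMDiffAt 𝓘(ℝ, E) 𝓘(ℝ, F) ∞ S P₀ ∧ ∀ᶠ q in nhds P₀, S q • P₀ = q := by
  have htop : IsTopologicalGroup H := topologicalGroup_of_lieGroup 𝓘(ℝ, F) ∞
  have hcsmul : ContinuousSMul H M :=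
    ContMDiffSMul.continuousSMul (I := 𝓘(ℝ, F)) (I' := 𝓘(ℝ, E)) ∞
  set κ := extChartAt 𝓘(ℝ, F) (1 : H) with hκ
  set φ := extChartAt 𝓘(ℝ, E) P₀ with hφ
  set x₀ := κ 1 with hx₀
  have hκx₀ : κ.symm x₀ = 1 := extChartAt_to_inv (I := 𝓘(ℝ, F)) 1
  have hx₀t : x₀ ∈ κ.target := mem_extChartAt_target 1
  have hκo : IsOpen κ.target := isOpen_extChartAt_target 1
  let ψ : F → E := fun x ↦ φ (κ.symm x • P₀)
  have hπ : ContMDiff 𝓘(ℝ, F) 𝓘(ℝ, E) ∞ (fun h : H ↦ h • P₀) :=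
    contMDiff_id.smul contMDiff_const
  have hκs : ∀ x ∈ κ.target, ContMDiffAt 𝓘(ℝ, F) 𝓘(ℝ, F) ∞ κ.symm x := fun x hx ↦
    (contMDiffOn_extChartAt_symm (1 : H) x hx).contMDiffAt (hκo.mem_nhds hx)
  have hψ : ContDiffAt ℝ ∞ ψ x₀ := by
    rw [← contMDiffAt_iff_contDiffAt]
    have h1 : ContMDiffAt 𝓘(ℝ, F) 𝓘(ℝ, E) ∞ (fun x ↦ κ.symm x • P₀) x₀ :=
      (hπ _).comp x₀ (hκs x₀ hx₀t)
    refine ContMDiffAt.comp x₀ (g := φ) ?_ h1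
    rw [hκx₀, one_smul]
    exact contMDiffAt_extChartAt
  have hψx₀ : ψ x₀ = φ P₀ := by simp only [ψ, hκx₀, one_smul]
  have hopen : nhds (ψ x₀) ≤ Filter.map ψ (nhds x₀) := by
    have h1 : Filter.map κ.symm (nhds x₀) = nhds 1 := by
      have := map_extChartAt_symm_nhdsWithin_range (I := 𝓘(ℝ, F)) (1 : H)
      rwa [modelWithCornersSelf_coe, Set.range_id, nhdsWithin_univ] at this
    have h2 : Filter.map φ (nhds P₀) = nhds (φ P₀) := map_extChartAt_nhds_of_boundaryless P₀
    have h3 : nhds P₀ ≤ Filter.map (fun h : H ↦ h • P₀) (nhds 1) := by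
      have := (isOpenMap_orbitMap (E := E) (F := F) (H := H) P₀).nhds_le 1
      rwa [one_smul] at this
    rw [hψx₀, ← h2]
    refine (Filter.map_mono h3).trans ?_
    rw [← h1, Filter.map_map, Filter.map_map]
    exact le_rfl
  have hrank : ∀ᶠ x in nhds x₀,
      Module.finrank ℝ (fderiv ℝ ψ x).range ≤ Module.finrank ℝ (fderiv ℝ ψ x₀).range := by
    have hcont : Filter.Tendsto (fun x ↦ κ.symm x • P₀) (nhds x₀) (nhds P₀) := by
      have : ContinuousAt (fun x ↦ κ.symm x • P₀) x₀ :=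
        ((hπ _).comp x₀ (hκs x₀ hx₀t)).continuousAt
      simpa [ContinuousAt, hκx₀] using this
    filter_upwards [hκo.mem_nhds hx₀t, hcont.eventually_mem
      (extChartAt_source_mem_nhds (I := 𝓘(ℝ, E)) P₀)] with x hxt hxs
    set h := κ.symm x with hh
    -- Since `h • ((h⁻¹ * k) • P₀) = k • P₀`, near `x` the map `ψ` is `a ∘ ψ ∘ b` with `b x = x₀`.
    -- Its rank at `x` is therefore at most that at `x₀`.
    let a : E → E := fun y ↦ φ (h • φ.symm y)
    let b : F → F := fun z ↦ κ (h⁻¹ * κ.symm z)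
    have hbx : b x = x₀ := by simp [b, ← hh, hx₀]
    have hb : DifferentiableAt ℝ b x := by
      rw [← mdifferentiableAt_iff_differentiableAt]
      have h1 : ContMDiffAt 𝓘(ℝ, F) 𝓘(ℝ, F) ∞ (fun z ↦ h⁻¹ * κ.symm z) x :=
        contMDiffAt_const.mul (hκs x hxt)
      refine (ContMDiffAt.comp x (g := κ) ?_ h1).mdifferentiableAt (by simp)
      rw [← hh, inv_mul_cancel]
      exact contMDiffAt_extChartAt
    have ha : DifferentiableAt ℝ a (ψ x₀) := by
      rw [← mdifferentiableAt_iff_differentiableAt]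
      have h1 : ContMDiffAt 𝓘(ℝ, E) 𝓘(ℝ, E) ∞ (fun y ↦ h • φ.symm y) (ψ x₀) := by
        refine (ContMDiffSMul.contMDiff_const_smul (I := 𝓘(ℝ, F)) h _).comp _ ?_
        rw [hψx₀]
        exact PseudoRiemannianMetric.contMDiffAt_extChartAt_symm P₀ (mem_extChartAt_target P₀)
      refine (ContMDiffAt.comp _ (g := φ) ?_ h1).mdifferentiableAt (by simp)
      refine contMDiffAt_extChartAt' ?_
      rw [← extChartAt_source (I := 𝓘(ℝ, E)), hψx₀, hφ, extChartAt_to_inv]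
      exact hxs
    have hfac : ψ =ᶠ[nhds x] a ∘ ψ ∘ b := by
      have hmul : ContinuousAt (fun z ↦ h⁻¹ * κ.symm z) x :=
        continuousAt_const.mul (hκs x hxt).continuousAt
      have h1 : ∀ᶠ z in nhds x, h⁻¹ * κ.symm z ∈ κ.source := by
        refine hmul.eventually_mem ?_
        rw [← hh, inv_mul_cancel]
        exact extChartAt_source_mem_nhds 1
      have h2 : ∀ᶠ z in nhds x, (h⁻¹ * κ.symm z) • P₀ ∈ φ.source := by
        refine (hmul.smul continuousAt_const).eventually_mem ?_
        change φ.source ∈ nhds ((h⁻¹ * κ.symm x) • P₀)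
        rw [← hh, inv_mul_cancel, one_smul]
        exact extChartAt_source_mem_nhds P₀
      filter_upwards [h1, h2] with z hz1 hz2
      simp only [Function.comp_apply, a, b, ψ]
      rw [κ.left_inv hz1, φ.left_inv hz2, smul_smul, mul_inv_cancel_left]
    have hψd := hψ.differentiableAt (by simp)
    have hD : fderiv ℝ ψ x = ((fderiv ℝ a (ψ x₀)).comp (fderiv ℝ ψ x₀)).comp (fderiv ℝ b x) := by
      rw [hfac.fderiv_eq]
      have h1 : HasFDerivAt ψ (fderiv ℝ ψ x₀) (b x) := by rw [hbx]; exact hψd.hasFDerivAt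
      have h2 : HasFDerivAt a (fderiv ℝ a (ψ x₀)) (ψ (b x)) := by
        rw [hbx]; exact ha.hasFDerivAt
      exact (h2.comp x (h1.comp x hb.hasFDerivAt)).fderiv
    rw [hD]
    have hle : (((fderiv ℝ a (ψ x₀)).comp (fderiv ℝ ψ x₀)).comp (fderiv ℝ b x)).range ≤
        (fderiv ℝ ψ x₀).range.map (fderiv ℝ a (ψ x₀) : E →ₗ[ℝ] E) := by
      rintro _ ⟨z, rfl⟩
      exact ⟨fderiv ℝ ψ x₀ (fderiv ℝ b x z), ⟨_, rfl⟩, rfl⟩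
    exact (Submodule.finrank_mono hle).trans (Submodule.finrank_map_le _ _)
  obtain ⟨s, hs, hsx₀, hsec⟩ :=
    hψ.exists_section (hψ.surjective_fderiv_of_open_of_rank_le hrank hopen)
  rw [hψx₀] at hs hsx₀ hsec
  have hsφ : ContMDiffAt 𝓘(ℝ, E) 𝓘(ℝ, F) ∞ (fun q ↦ s (φ q)) P₀ :=
    hs.contMDiffAt.comp P₀ contMDiffAt_extChartAt
  have hS : ContMDiffAt 𝓘(ℝ, E) 𝓘(ℝ, F) ∞ (fun q ↦ κ.symm (s (φ q))) P₀ := by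
    refine ContMDiffAt.comp P₀ (g := κ.symm) ?_ hsφ
    rw [hsx₀]
    exact hκs x₀ hx₀t
  refine ⟨fun q ↦ κ.symm (s (φ q)), hS, ?_⟩
  have h1 : ∀ᶠ q in nhds P₀, ψ (s (φ q)) = φ q :=
    (continuousAt_extChartAt (I := 𝓘(ℝ, E)) P₀).eventually hsec
  have h2 : ∀ᶠ q in nhds P₀, κ.symm (s (φ q)) • P₀ ∈ φ.source := by
    refine (hS.continuousAt.smul continuousAt_const).eventually_mem ?_
    change φ.source ∈ nhds (κ.symm (s (φ P₀)) • P₀)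
    rw [hsx₀, hκx₀, one_smul]
    exact extChartAt_source_mem_nhds P₀
  filter_upwards [h1, h2, extChartAt_source_mem_nhds (I := 𝓘(ℝ, E)) P₀] with q hq1 hq2 hq3
  exact φ.injOn hq2 hq3 hq1

/-- A function on a homogeneous space that is multiplied by a smooth character under the action
is smooth. -/
theorem contMDiff_of_equivariant (hsmul : ContMDiffSMul 𝓘(ℝ, F) 𝓘(ℝ, E) ∞ H M)
    (htrans : MulAction.IsPretransitive H M) (P₀ : M) {lam : H → ℝ}
    (hlam : ContMDiff 𝓘(ℝ, F) 𝓘(ℝ, ℝ) ∞ lam) {f : M → ℝ}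
    (hf : ∀ h : H, f (h • P₀) = lam h) (hmul : ∀ (h : H) (p : M), f (h • p) = lam h * f p) :
    ContMDiff 𝓘(ℝ, E) 𝓘(ℝ, ℝ) ∞ f := by
  obtain ⟨S, hS, hsec⟩ := exists_orbitMap_section hsmul htrans P₀
  have h0 : ContMDiffAt 𝓘(ℝ, E) 𝓘(ℝ, ℝ) ∞ f P₀ := by
    refine ((hlam _).comp P₀ hS).congr_of_eventuallyEq ?_
    filter_upwards [hsec] with q hq
    rw [Function.comp_apply, ← hf, hq]
  intro p
  obtain ⟨h, hh⟩ := MulAction.exists_smul_eq H p P₀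
  -- Equivariance carries smoothness from `P₀` to `p`.
  have h1 : f = fun q ↦ lam h⁻¹ * f (h • q) := by
    funext q
    rw [← hmul, inv_smul_smul]
  rw [h1]
  refine contMDiffAt_const.mul (ContMDiffAt.comp p (g := f) ?_
    (ContMDiffSMul.contMDiff_const_smul (I := 𝓘(ℝ, F)) h p))
  rw [hh]
  exact h0

end OrbitMap

/-! ### The passage between the two kinds of structure. -/

section Structures

variable {E : Type*} [NormedAddCommGroup E] [NormedSpace ℝ E]
  {M : Type*} [TopologicalSpace M] [ChartedSpace E M] [IsManifold 𝓘(ℝ, E) ∞ M]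

/-- Serves both directions: a conformal factor turns isometries into homotheties, and its inverse
turns them back. -/
theorem PseudoRiemannianMetric.PullbackEqSq.of_conformal {g₀ g : PseudoRiemannianMetric E M}
    {T : M → M} {c d : ℝ} {f : M → ℝ} (h : g₀.PullbackEqSq T c)
    (hg : ∀ p, g.inner p = f p • g₀.inner p) (hf : ∀ p, f (T p) * c ^ 2 = d ^ 2 * f p) :
    g.PullbackEqSq T d := by
  intro p v w
  have h1 : ∀ (q : M) (x y : TangentSpace 𝓘(ℝ, E) q),
      g.inner q x y = f q * g₀.inner q x y := fun q x y ↦ by rw [hg]; rfl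
  rw [h1, h1, h p v w, ← mul_assoc, hf, mul_assoc]

variable {F : Type*} [NormedAddCommGroup F] [NormedSpace ℝ F]
  {H : Type*} [TopologicalSpace H] [ChartedSpace F H] [Group H] [MulAction H M]

theorem HasHomothetyCharacter.isHomothetyHomogeneous {g : PseudoRiemannianMetric E M}
    {lam : H → ℝ} (hg : HasHomothetyCharacter F g lam) : g.IsHomothetyHomogeneous := by
  have := hg.smooth_action
  have := hg.transitive
  intro p q
  obtain ⟨h, hh⟩ := MulAction.exists_smul_eq H p q
  exact ⟨⟨MulAction.toPerm h, ContMDiffSMul.contMDiff_const_smul (I := 𝓘(ℝ, F)) h,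
    ContMDiffSMul.contMDiff_const_smul (I := 𝓘(ℝ, F)) h⁻¹⟩, ⟨lam h, hg.pos h, hg.homothety h⟩, hh⟩

theorem IsPStructure.lam_eq_of_smul_eq {g₀ : PseudoRiemannianMetric E M} {lam : H → ℝ} {P₀ : M}
    (hP : IsPStructure F g₀ lam P₀) {h k : H} (hk : h • P₀ = k • P₀) : lam h = lam k := by
  have h1 : k⁻¹ * h ∈ MulAction.stabilizer H P₀ := by
    rw [MulAction.mem_stabilizer_iff, mul_smul, hk, inv_smul_smul]
  have h2 := hP.map_mul k (k⁻¹ * h)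
  rwa [hP.isotropy _ h1, mul_one, mul_inv_cancel_left] at h2

/-- The character of a `𝔓`-structure descends to a function on the manifold. -/
theorem IsPStructure.exists_potential {g₀ : PseudoRiemannianMetric E M} {lam : H → ℝ} {P₀ : M}
    (hP : IsPStructure F g₀ lam P₀) :
    ∃ f : M → ℝ, (∀ h : H, f (h • P₀) = lam h) ∧
      (∀ (h : H) (p : M), f (h • p) = lam h * f p) ∧ ∀ p, 0 < f p := by
  have := hP.transitive
  choose s hs using MulAction.exists_smul_eq H P₀
  have h1 : ∀ h : H, lam (s (h • P₀)) = lam h := fun h ↦ hP.lam_eq_of_smul_eq (hs _)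
  refine ⟨fun p ↦ lam (s p), h1, fun h p ↦ ?_, fun p ↦ hP.pos _⟩
  rw [← hP.map_mul, ← h1 (h * s p), mul_smul, hs]

theorem IsPStructure.hasHomothetyCharacter {g₀ g : PseudoRiemannianMetric E M} {lam : H → ℝ}
    {P₀ : M} (hP : IsPStructure F g₀ lam P₀) (hg : IsRescaling g₀ lam P₀ g) :
    HasHomothetyCharacter F g lam := by
  have := hP.transitive
  obtain ⟨f, hf, hmul, -⟩ := hP.exists_potential
  refine ⟨hP.smooth_action, hP.transitive, hP.effective, hP.pos, fun h ↦ ?_⟩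
  refine (hP.isometry h).of_conformal (f := fun p ↦ f p ^ 2) (fun p ↦ ?_) (fun p ↦ ?_)
  · obtain ⟨k, rfl⟩ := MulAction.exists_smul_eq H P₀ p
    rw [hg (lam k) (k • P₀) ⟨k, rfl, rfl⟩, hf]
  · rw [hmul]
    ring

variable [FiniteDimensional ℝ E] [FiniteDimensional ℝ F] [LieGroup 𝓘(ℝ, F) ∞ H] [T2Space M]
  [SecondCountableTopology H]

theorem IsPStructure.existsUnique_isRescaling {g₀ : PseudoRiemannianMetric E M} {lam : H → ℝ}
    {P₀ : M} (hP : IsPStructure F g₀ lam P₀) :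
    ∃! g : PseudoRiemannianMetric E M, IsRescaling g₀ lam P₀ g := by
  have := hP.transitive
  obtain ⟨f, hf, hmul, hpos⟩ := hP.exists_potential
  have hsmooth : ContMDiff 𝓘(ℝ, E) 𝓘(ℝ, ℝ) ∞ f :=
    contMDiff_of_equivariant hP.smooth_action hP.transitive P₀ hP.smooth_character hf hmul
  refine ⟨g₀.rescale (fun p ↦ f p ^ 2) (hsmooth.pow 2) (fun p ↦ (pow_pos (hpos p) 2).ne'), ?_, ?_⟩
  · rintro t _ ⟨h, rfl, rfl⟩
    change f (h • P₀) ^ 2 • g₀.inner (h • P₀) = _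
    rw [hf]
  · intro g hg
    refine PseudoRiemannianMetric.ext_inner fun p ↦ ?_
    obtain ⟨h, rfl⟩ := MulAction.exists_smul_eq H P₀ p
    rw [hg (lam h) (h • P₀) ⟨h, rfl, rfl⟩]
    change _ = f (h • P₀) ^ 2 • g₀.inner (h • P₀)
    rw [hf]

theorem HasHomothetyCharacter.exists_isPStructure {g : PseudoRiemannianMetric E M} {lam : H → ℝ}
    (P₀ : M) (hg : HasHomothetyCharacter F g lam) (hnt : ∃ h, lam h ≠ 1) (hvsi : ¬ g.IsVSI) :
    ∃ g₀ : PseudoRiemannianMetric E M, IsPStructure F g₀ lam P₀ ∧ IsRescaling g₀ lam P₀ g := by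
  have hsmul := hg.smooth_action
  have htrans := hg.transitive
  simp only [PseudoRiemannianMetric.IsVSI, not_forall] at hvsi
  obtain ⟨c, p₁, hp₁⟩ := hvsi
  set N := c.pairs - c.factors with hN
  have hN0 : 2 * N ≠ 0 := by have := c.pairs_sub_factors_pos; omega
  set w := g.weylScalar c with hw
  have hwt : ∀ (h : H) (p : M), w p = lam h ^ (2 * N) * w (h • p) := by
    intro h p
    rw [pow_mul]
    exact (hg.homothety h).weylScalar_eq
      (ContMDiffSMul.contMDiff_const_smul (I := 𝓘(ℝ, F)) h) (hg.pos h).ne' c p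
  -- By the scaling law a zero of `w` would spread over the whole orbit, up to `p₁`.
  have hw0 : ∀ p, w p ≠ 0 := by
    intro p hp
    obtain ⟨h, rfl⟩ := MulAction.exists_smul_eq H p₁ p
    apply hp₁
    rw [hwt h, hp, mul_zero]
  have hquot : ∀ h : H, w P₀ / w (h • P₀) = lam h ^ (2 * N) := fun h ↦ by
    rw [hwt h P₀, mul_div_cancel_right₀ _ (hw0 _)]
  have hqpos : ∀ p, 0 < w P₀ / w p := by
    intro p
    obtain ⟨h, rfl⟩ := MulAction.exists_smul_eq H P₀ p
    rw [hquot]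
    exact pow_pos (hg.pos h) _
  -- The quotient is positive whatever the sign of `w`, and its root of order `2 * N` recovers `lam`
  -- along the orbit.
  set f : M → ℝ := fun p ↦ (w P₀ / w p) ^ (((2 * N : ℕ) : ℝ)⁻¹) with hfdef
  have hf : ∀ h : H, f (h • P₀) = lam h := fun h ↦ by
    simp only [hfdef, hquot]
    exact Real.pow_rpow_inv_natCast (hg.pos h).le hN0
  have hfpos : ∀ p, 0 < f p := fun p ↦ Real.rpow_pos_of_pos (hqpos p) _
  have hwsmooth : ContMDiff 𝓘(ℝ, E) 𝓘(ℝ, ℝ) ∞ w := g.contMDiff_weylScalar c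
  have hfsmooth : ContMDiff 𝓘(ℝ, E) 𝓘(ℝ, ℝ) ∞ f := by
    intro p
    have h1 : ContDiffAt ℝ ∞ (fun x : ℝ ↦ (w P₀ / x) ^ (((2 * N : ℕ) : ℝ)⁻¹)) (w p) :=
      (contDiffAt_const.div contDiffAt_id (hw0 p)).rpow_const_of_ne (hqpos p).ne'
    exact h1.contMDiffAt.comp p (hwsmooth p)
  have hmap : ∀ h k, lam (h * k) = lam h * lam k := by
    intro h k
    -- Multiplicativity: the law for `h * k` is compared with the laws for `k` and `h` in
    -- succession, and the `2 * N`-th powers are removed by positivity.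
    have h1 := hwt (h * k) P₀
    rw [hwt k P₀, hwt h (k • P₀), ← mul_assoc, ← mul_pow, mul_smul] at h1
    have h2 := mul_right_cancel₀ (hw0 _) h1
    rw [mul_comm (lam h)]
    exact (pow_left_inj₀ (hg.pos _).le (mul_pos (hg.pos _) (hg.pos _)).le hN0).1 h2.symm
  have hmul : ∀ (h : H) (p : M), f (h • p) = lam h * f p := by
    intro h p
    obtain ⟨k, rfl⟩ := MulAction.exists_smul_eq H P₀ p
    rw [smul_smul, hf, hf, hmap]
  have hf2 : ContMDiff 𝓘(ℝ, E) 𝓘(ℝ, ℝ) ∞ (fun p ↦ (f p ^ 2)⁻¹) := by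
    intro p
    have h1 : ContDiffAt ℝ ∞ (fun x : ℝ ↦ (x ^ 2)⁻¹) (f p) :=
      (contDiffAt_id.pow 2).inv (pow_pos (hfpos p) 2).ne'
    exact h1.contMDiffAt.comp p (hfsmooth p)
  refine ⟨g.rescale (fun p ↦ (f p ^ 2)⁻¹) hf2 fun p ↦ inv_ne_zero (pow_pos (hfpos p) 2).ne', ?_, ?_⟩
  · refine ⟨hsmul, htrans, hg.effective, fun h ↦ ?_, hg.pos, hmap, ?_, hnt, fun h hh ↦ ?_⟩
    · refine (hg.homothety h).of_conformal (f := fun p ↦ (f p ^ 2)⁻¹) (fun p ↦ rfl) fun p ↦ ?_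
      have := (hg.pos h).ne'
      have := (hfpos p).ne'
      rw [hmul]
      field_simp
    · have h1 : ContMDiff 𝓘(ℝ, F) 𝓘(ℝ, ℝ) ∞ (fun h : H ↦ f (h • P₀)) :=
        hfsmooth.comp (contMDiff_id.smul contMDiff_const)
      simpa only [hf] using h1
    · rw [← hf h, MulAction.mem_stabilizer_iff.1 hh, ← one_smul H P₀, hf]
      have h1 := hmap 1 1
      rw [mul_one] at h1
      exact (mul_eq_left₀ (hg.pos 1).ne').1 h1.symm
  · rintro t _ ⟨h, rfl, rfl⟩
    change _ = lam h ^ 2 • ((f (h • P₀) ^ 2)⁻¹ • g.inner (h • P₀))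
    rw [hf, smul_smul, mul_inv_cancel₀ (pow_pos (hg.pos h) 2).ne', one_smul]

end Structures

theorem theorem1p8
    {E : Type*} [NormedAddCommGroup E] [NormedSpace ℝ E] [FiniteDimensional ℝ E]
    {M : Type*} [TopologicalSpace M] [ChartedSpace E M] [IsManifold 𝓘(ℝ, E) ∞ M]
    [T2Space M] [SecondCountableTopology M] [ConnectedSpace M]
    {F : Type*} [NormedAddCommGroup F] [NormedSpace ℝ F] [FiniteDimensional ℝ F]
    {H : Type*} [TopologicalSpace H] [ChartedSpace F H] [Group H] [LieGroup 𝓘(ℝ, F) ∞ H]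
    [T2Space H] [SecondCountableTopology H] [ConnectedSpace H] [MulAction H M]
    (lam : H → ℝ) (P₀ : M) :
    (∀ g₀ : PseudoRiemannianMetric E M, IsPStructure F g₀ lam P₀ →
      (∃! g : PseudoRiemannianMetric E M, IsRescaling g₀ lam P₀ g) ∧
      ∀ g : PseudoRiemannianMetric E M, IsRescaling g₀ lam P₀ g →
        g.IsHomothetyHomogeneous ∧ HasHomothetyCharacter F g lam) ∧
    (∀ g : PseudoRiemannianMetric E M, HasHomothetyCharacter F g lam → (∃ h, lam h ≠ 1) →
      ¬ g.IsVSI →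
      ∃ g₀ : PseudoRiemannianMetric E M, IsPStructure F g₀ lam P₀ ∧ IsRescaling g₀ lam P₀ g) :=
  ⟨fun _ hP ↦ ⟨hP.existsUnique_isRescaling, fun _ hg ↦
      ⟨(hP.hasHomothetyCharacter hg).isHomothetyHomogeneous, hP.hasHomothetyCharacter hg⟩⟩,
    fun _ hg hnt hvsi ↦ hg.exists_isPStructure P₀ hnt hvsi⟩
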